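/- Let $t_0\in\mathbb R$, let $\mathcal N^o\subseteq\mathbb N$, let $f_\sigma:\mathbb R^n\times[t_0,\infty)\to\mathbb R^n$ ($\sigma\in\mathcal N^o$) and let $\rho:\mathbb R^n\times[t_0,\infty)\to\mathcal N^o$ be a switching signal such that for every $(x,t)$ there is $\delta^*>0$ for which $\rho(\mathrm B(x,\delta^*),t)$ is finite. Put $f(x,t):=f_{\rho(x,t)}(x,t)$. For $g:\mathbb R^n\times[t_0,\infty)\to\mathbb R^n$ let $\mathrm K_{\mathbb K}[g](x,t)=\bigcap_{\delta>0}\overline{\mathrm{co}}\{g(y,t): y\in \mathrm B(x,\delta)\}$ (Krasovskii regularization) and $\mathrm K_{\mathbb F}[g](x,t)=\bigcap_{\delta>0}\bigcap_{\mu(N)=0}\overline{\mathrm{co}}\{g(y,t): y\in \mathrm B(x,\delta)\setminus N\}$ (Filippov regularization). Let $\mathrm K=\mathrm K_{\mathbb K}$ and assume that $\{f_\sigma\}$ is locally bounded, uniformly in $\sigma$ and $t$ (for each compact $K\subset\mathbb R^n$ there is $M$ with $\|f_\sigma(x,t)\|\le M$ for all $x\in K$, $t\ge t_0$, $\sigma\in\mathcal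 N^o$), and that $t\mapsto f_\sigma(x,t)$ and $t\mapsto\rho(x,t)$ are Lebesgue measurable for all $x$ and $\sigma$. Alternatively, let $\mathrm K=\mathrm K_{\mathbb F}$ and assume that $\{f_\sigma\}$ is locally essentially bounded in $x$, uniformly in $\sigma$ and $t$ (the same bound, for each $\sigma$ and $t$ for almost every $x\in K$), and that $(x,t)\mapsto f_\sigma(x,t)$ and $(x,t)\mapsto\rho(x,t)$ are Lebesgue measurable for all $\sigma$. Let $\mathcal D\subseteq\mathbb R^n$ be open and connected and $\Omega=\mathcal D\times[t_0,\infty)$. Assume that there are a locally Lipschitz positive definite function $V:\Omega\to\mathbb R$, continuous positive definite functions $\underline W,\overline W:\mathcal D\to\mathbb R$ and a continuous positive semidefinite function $W:\mathcal D\to\mathbb R$ such that $\underline W(x)\le V(x,t)\le\overline W(x)$ on $\Omega$ and such that $V$ is a common non-strict Lyapunov function for the regularized subsystems: for every $\sigma\in\mathcal N^o$, $\mathrm K[f_\sigma]$ has nonempty compact values on $\Omega$, and for almost every $t\ge t_0$ and all $x\in\mathcal D$, $$\max_{p\in\partial V(x,t)}\ \max_{q\in \mathrm K[f_\sigma](x,t)}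 p^T[q;1]\le -W(x),$$ where $\partial V$ is the Clarke gradient of $V$ with respect to $(x,t)$. A solution of $\dot x\in \mathrm K[f](x,t)$ is a locally absolutely continuous function on an interval of nonzero length with minimum $t_0$ that satisfies the inclusion almost everywhere; it is maximal if it has no proper extension to the right that is a solution, and complete if it is defined on $[t_0,\infty)$. (i) Let $r>0$ be such that $\overline{\mathrm B}(0,r)\subset\mathcal D$ and let $0<c<\min_{\|x\|=r}\underline W(x)$. Then every solution of $\dot x\in \mathrm K[f](x,t)$ with $x(t_0)\in\{x\in \mathrm B(0,r):\overline W(x)\le c\}$ extends to a maximal solution, and every maximal solution with such an initial value is complete, bounded, and satisfies $\lim_{t\to\infty}W(x(t))=0$. (ii) If $\mathcal D=\mathbb R^n$ and the sets $\{x\in\mathbb R^n:\underline W(x)\le c\}$ are compact for all $c>0$, then the same conclusion holds for every initial value $x(t_0)\in\mathbb R^n$. -/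

import Mathlib

open Set Filter Topology MeasureTheory

namespace SwitchedSystem

/-- The state space `ℝⁿ` with its Euclidean norm. -/
abbrev State (n : ℕ) : Type := EuclideanSpace ℝ (Fin n)

/-! ### Regularizations of a time-dependent vector field -/

/-- The Krasovskii regularization
`K[g](x,t) = ⋂_{δ>0} closure (co {g(y,t) | y ∈ B(x,δ)})`. -/
def krasovskiiReg {n : ℕ} (g : State n → ℝ → State n) (x : State n) (t : ℝ) : Set (State n) :=
  ⋂ (δ : ℝ) (_ : 0 < δ), closedConvexHull ℝ ((fun y => g y t) '' Metric.ball x δ)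

/-- The Filippov regularization
`F[g](x,t) = ⋂_{δ>0} ⋂_{μ(N)=0} closure (co {g(y,t) | y ∈ B(x,δ) \ N})`. -/
def filippovReg {n : ℕ} (g : State n → ℝ → State n) (x : State n) (t : ℝ) : Set (State n) :=
  ⋂ (δ : ℝ) (_ : 0 < δ) (N : Set (State n)) (_ : volume N = 0),
    closedConvexHull ℝ ((fun y => g y t) '' (Metric.ball x δ \ N))

/-! ### Switched systems -/

/-- The right-hand side `f(x,t) = f_{ρ(x,t)}(x,t)` of the switched system. -/
def switchedField {n : ℕ} (f : ℕ → State n → ℝ → State n) (ρ : State n → ℝ → ℕ) :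
    State n → ℝ → State n :=
  fun x t => f (ρ x t) x t

/-- Near each state, at each time, only finitely many modes are active. -/
def LocallyFiniteSwitching {n : ℕ} (t₀ : ℝ) (ρ : State n → ℝ → ℕ) : Prop :=
  ∀ x : State n, ∀ t : ℝ, t₀ ≤ t →
    ∃ δ : ℝ, 0 < δ ∧ ((fun y => ρ y t) '' Metric.ball x δ).Finite

/-- Standing assumptions on the data `f_σ` (`σ ∈ N₀`), `ρ` when Krasovskii regularizations are
used: the modes are locally bounded, uniformly in `σ` and `t`, and the maps
`t ↦ f_σ(x,t)`, `t ↦ ρ(x,t)` on `[t₀,∞)` are Lebesgue measurable for every `x`. -/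
structure KrasovskiiData {n : ℕ} (t₀ : ℝ) (N₀ : Set ℕ) (f : ℕ → State n → ℝ → State n)
    (ρ : State n → ℝ → ℕ) : Prop where
  mode_mem : ∀ x : State n, ∀ t : ℝ, t₀ ≤ t → ρ x t ∈ N₀
  locally_bounded : ∀ K : Set (State n), IsCompact K →
    ∃ M : ℝ, 0 < M ∧ ∀ σ ∈ N₀, ∀ t : ℝ, t₀ ≤ t → ∀ x ∈ K, ‖f σ x t‖ ≤ M
  measurable_field : ∀ σ ∈ N₀, ∀ x : State n,
    AEMeasurable (fun t => f σ x t) (volume.restrict (Ici t₀))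
  measurable_signal : ∀ x : State n,
    AEMeasurable (fun t => ρ x t) (volume.restrict (Ici t₀))

/-- Standing assumptions on the data `f_σ` (`σ ∈ N₀`), `ρ` when Filippov regularizations are
used: the modes are locally essentially bounded in `x`, uniformly in `σ` and `t`, and the maps
`(x,t) ↦ f_σ(x,t)`, `(x,t) ↦ ρ(x,t)` on `ℝⁿ × [t₀,∞)` are Lebesgue measurable. -/
structure FilippovData {n : ℕ} (t₀ : ℝ) (N₀ : Set ℕ) (f : ℕ → State n → ℝ → State n)
    (ρ : State n → ℝ → ℕ) : Prop where
  mode_mem : ∀ x : State n, ∀ t : ℝ, t₀ ≤ t → ρ x t ∈ N₀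
  locally_ess_bounded : ∀ K : Set (State n), IsCompact K →
    ∃ M : ℝ, 0 < M ∧ ∀ σ ∈ N₀, ∀ t : ℝ, t₀ ≤ t →
      ∀ᵐ x : State n, x ∈ K → ‖f σ x t‖ ≤ M
  measurable_field : ∀ σ ∈ N₀,
    AEMeasurable (fun p : State n × ℝ => f σ p.1 p.2) (volume.restrict (univ ×ˢ Ici t₀))
  measurable_signal :
    AEMeasurable (fun p : State n × ℝ => ρ p.1 p.2) (volume.restrict (univ ×ˢ Ici t₀))

/-! ### Solutions of differential inclusions -/

/-- `x`, restricted to the interval `I` of nonzero length with least element `t₀`, is a solution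
of `ẋ ∈ F(x,t)` over `I`: it is locally absolutely continuous on `I`, and for almost all `t ∈ I`
it is differentiable with derivative in `F(x(t),t)`. The values of `x` outside `I` play no role. -/
structure IsSolution {n : ℕ} (F : State n → ℝ → Set (State n)) (t₀ : ℝ)
    (x : ℝ → State n) (I : Set ℝ) : Prop where
  ordConnected : I.OrdConnected
  nontrivial : I.Nontrivial
  isLeast : IsLeast I t₀
  absolutelyContinuous : ∀ a ∈ I, ∀ b ∈ I, AbsolutelyContinuousOnInterval x a b
  inclusion : ∀ᵐ t : ℝ, t ∈ I → ∃ q ∈ F (x t) t, HasDerivWithinAt x q I t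

/-- A solution is maximal if it has no proper extension to the right that is a solution. -/
def IsMaximalSolution {n : ℕ} (F : State n → ℝ → Set (State n)) (t₀ : ℝ)
    (x : ℝ → State n) (I : Set ℝ) : Prop :=
  IsSolution F t₀ x I ∧
    ∀ (y : ℝ → State n) (J : Set ℝ), IsSolution F t₀ y J → I ⊆ J → EqOn x y I → J = I

/-- Every solution of `ẋ ∈ F(x,t)` with `x(t₀) ∈ S` is complete, bounded, and satisfies
`W(x(t)) → 0`: it is the restriction of a maximal solution, and every maximal solution with
`x(t₀) ∈ S` is defined on all of `[t₀,∞)`, is bounded, and satisfies `W(x(t)) → 0` as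
`t → ∞`. -/
def SolutionsCompleteBoundedConverge {n : ℕ} (F : State n → ℝ → Set (State n)) (t₀ : ℝ)
    (W : State n → ℝ) (S : Set (State n)) : Prop :=
  (∀ (x : ℝ → State n) (I : Set ℝ), IsSolution F t₀ x I → x t₀ ∈ S →
    ∃ (y : ℝ → State n) (J : Set ℝ), IsMaximalSolution F t₀ y J ∧ I ⊆ J ∧ EqOn x y I) ∧
  (∀ (x : ℝ → State n) (I : Set ℝ), IsMaximalSolution F t₀ x I → x t₀ ∈ S →
    I = Ici t₀ ∧ Bornology.IsBounded (x '' I) ∧ Tendsto (fun t => W (x t)) atTop (𝓝 0))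

/-! ### Clarke gradient and non-strict Lyapunov functions -/

/-- Clarke's generalized directional derivative of `V : ℝⁿ × ℝ → ℝ` at `z` in the direction `v`,
`V°(z;v) = limsup_{y → z, s ↓ 0} (V(y + s v) - V(y)) / s`. -/
noncomputable def clarkeDeriv {n : ℕ} (V : State n → ℝ → ℝ) (z v : State n × ℝ) : EReal :=
  limsup
    (fun q : (State n × ℝ) × ℝ =>
      (((V (q.1 + q.2 • v).1 (q.1 + q.2 • v).2 - V q.1.1 q.1.2) / q.2 : ℝ) : EReal))
    (𝓝 z ×ˢ 𝓝[>] (0 : ℝ))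

/-- The Clarke gradient `∂V(x,t) = {p ∈ ℝⁿ × ℝ | pᵀ v ≤ V°((x,t);v) for all v}`. -/
def clarkeGradient {n : ℕ} (V : State n → ℝ → ℝ) (x : State n) (t : ℝ) : Set (State n × ℝ) :=
  {p | ∀ v : State n × ℝ,
    ((inner ℝ p.1 v.1 + p.2 * v.2 : ℝ) : EReal) ≤ clarkeDeriv V (x, t) v}

/-- The generalized time derivative
`max_{p ∈ ∂V(x,t)} max_{q ∈ F(x,t)} pᵀ [q; 1]` of `V` with respect to `F`. -/
noncomputable def generalizedTimeDeriv {n : ℕ} (F : State n → ℝ → Set (State n))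
    (V : State n → ℝ → ℝ) (x : State n) (t : ℝ) : EReal :=
  ⨆ p ∈ clarkeGradient V x t, ⨆ q ∈ F x t, ((inner ℝ p.1 q + p.2 * 1 : ℝ) : EReal)

/-- `W` is positive definite on `D`: it vanishes at the origin and is positive elsewhere. -/
def PosDefOn {n : ℕ} (D : Set (State n)) (W : State n → ℝ) : Prop :=
  ∀ x ∈ D, 0 ≤ W x ∧ (W x = 0 ↔ x = 0)

/-- `V` is a non-strict Lyapunov function for `F` over `Ω = D × [t₀,∞)` with the bounds
`Wl ≤ V ≤ Wu` and `W`. Only values on `Ω` matter: for `t > t₀` the Clarke gradient depends only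
on `V` near `(x,t)`, and the single time `t₀` is irrelevant for the almost-everywhere condition.
(Nonnegativity of `W` is all that is asked of a positive semidefinite function; `W 0 = 0` then
follows from the other conditions if `0 ∈ D`.) -/
structure IsNonStrictLyapunov {n : ℕ} (F : State n → ℝ → Set (State n)) (t₀ : ℝ)
    (D : Set (State n)) (V : State n → ℝ → ℝ) (Wl Wu W : State n → ℝ) : Prop where
  nonempty_compact : ∀ x ∈ D, ∀ t : ℝ, t₀ ≤ t → (F x t).Nonempty ∧ IsCompact (F x t)
  locallyLipschitz : LocallyLipschitzOn (D ×ˢ Ici t₀) (fun p : State n × ℝ => V p.1 p.2)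
  posDef : ∀ t : ℝ, t₀ ≤ t → PosDefOn D (fun x => V x t)
  continuous_lower : ContinuousOn Wl D
  continuous_upper : ContinuousOn Wu D
  continuous_rate : ContinuousOn W D
  posDef_lower : PosDefOn D Wl
  posDef_upper : PosDefOn D Wu
  nonneg_rate : ∀ x ∈ D, 0 ≤ W x
  bounds : ∀ x ∈ D, ∀ t : ℝ, t₀ ≤ t → Wl x ≤ V x t ∧ V x t ≤ Wu x
  decrease : ∀ᵐ t : ℝ, t₀ ≤ t → ∀ x ∈ D, generalizedTimeDeriv F V x t ≤ ((-W x : ℝ) : EReal)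

/-- `V` is a common non-strict Lyapunov function for the family `F_σ`, `σ ∈ N₀`: the same `V`
and the same bounds work for every `σ`. -/
def IsCommonNonStrictLyapunov {n : ℕ} (N₀ : Set ℕ) (F : ℕ → State n → ℝ → Set (State n))
    (t₀ : ℝ) (D : Set (State n)) (V : State n → ℝ → ℝ) (Wl Wu W : State n → ℝ) : Prop :=
  ∀ σ ∈ N₀, IsNonStrictLyapunov (F σ) t₀ D V Wl Wu W

end SwitchedSystem

/-!
The Krasovskii and the Filippov regularization are both intersections, over balls around `x` and
over a family `𝒩` of negligible sets, of closed convex hulls of values: `𝒩 = {∅}` for the former,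
`𝒩` the null sets for the latter (`reg`). The whole argument runs for `reg 𝒩`.

*The common Lyapunov function survives switching.* Fix `(x,t)` and `p ∈ ∂V(x,t)`. The condition
`pᵀ[q;1] ≤ -W(x)` confines `q` to a closed half-space that contains every regularized mode
`reg 𝒩 (f σ) x t`. By compactness, the values of `f σ` near `x` lie, off a negligible set, in a
slightly larger half-space, and since only finitely many modes are active near `x`, the same holds
for the switched field. So its regularization lies in the half-space
(`inner_le_of_mem_reg_switchedField`).

*Decrease along solutions.* `V` along a solution is absolutely continuous, its derivative is at
most Clarke's directional derivative in the direction `(q,1)`, and the latter is attained on the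
Clarke gradient by the Hahn–Banach theorem (`exists_mem_clarkeGradient`). Hence `V` decreases at
least by `∫ W` (`energy_le`). The bounds on `V` then confine the solution to a compact set.

*Completeness.* Solutions extend to maximal ones by Zorn's lemma. A bounded maximal solution is
Lipschitz, so it would have a limit at a finite final time, and a local solution could be attached
there (`IsMaximalSolution.eq_Ici`). The local solution (`exists_local_trajectory`) is a limit of
Euler polygons for maps that sample the field measurably in time: the field itself in the
Krasovskii case, its averages over small balls in the Filippov case. The polygons converge
pointwise along a subsequence, convex combinations of their velocities converge in `L²` by Mazur's
lemma, and the limit velocity lies in the closed convex sets that define the regularization.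

*Convergence.* `∫ W(x(t)) dt` is finite and `W ∘ x` is uniformly continuous, so Barbalat's lemma
gives `W(x(t)) → 0`.
-/

namespace SwitchedSystem

variable {n : ℕ}

/-! ### Regularizations relative to a family of negligible sets -/

/-- The closed convex hull of the values of `g(·,t)` on `B(x,δ) \ N`. -/
def ballHull (g : State n → ℝ → State n) (δ : ℝ) (N : Set (State n)) (x : State n) (t : ℝ) :
    Set (State n) :=
  closedConvexHull ℝ ((fun y => g y t) '' (Metric.ball x δ \ N))

/-- The regularization of `g` that ignores the sets of a family `𝒩`. It is the Krasovskii
regularization for `𝒩 = {∅}` and the Filippov regularization for the family of null sets. -/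
def reg (𝒩 : Set (Set (State n))) (g : State n → ℝ → State n) (x : State n) (t : ℝ) :
    Set (State n) :=
  ⋂ (δ : ℝ) (_ : 0 < δ) (N : Set (State n)) (_ : N ∈ 𝒩), ballHull g δ N x t

/-- A nonempty family of sets that is closed under countable unions. Closure under subsets is not
required, so that `{∅}` and the null sets are both instances. -/
structure IsNegligibleFamily (𝒩 : Set (Set (State n))) : Prop where
  nonempty : 𝒩.Nonempty
  iUnion_mem : ∀ s : ℕ → Set (State n), (∀ i, s i ∈ 𝒩) → ⋃ i, s i ∈ 𝒩

/-- On each compact set `g(·,t)` is bounded outside a member of `𝒩` that may depend on `t`, by a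
constant that does not. -/
def LocallyBoundedMod (𝒩 : Set (Set (State n))) (t₀ : ℝ) (g : State n → ℝ → State n) : Prop :=
  ∀ K : Set (State n), IsCompact K → ∃ M : ℝ, 0 < M ∧ ∀ t : ℝ, t₀ ≤ t →
    ∃ N ∈ 𝒩, ∀ x ∈ K \ N, ‖g x t‖ ≤ M

/-- A field `g` is sampled by maps `s k` that are measurable in time and whose values at `(y,t)`
are, up to the negligible sets, averages of values of `g(·,t)` near `y`. The sampling maps replace
`g` in the construction of solutions, since `t ↦ g(y,t)` need not be measurable, nor `g(y,t)`
belong to the regularization, for a given `y`. -/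
def HasSampling (𝒩 : Set (Set (State n))) (t₀ : ℝ) (g : State n → ℝ → State n) : Prop :=
  ∃ s : ℕ → State n → ℝ → State n,
    (∀ k y, AEMeasurable (s k y) (volume.restrict (Ici t₀))) ∧
    ∀ k : ℕ, ∀ᵐ t : ℝ, t₀ ≤ t → ∀ (y : State n) (δ : ℝ), 1 / ((k : ℝ) + 1) < δ → ∀ N ∈ 𝒩,
      s k y t ∈ ballHull g δ N y t

theorem krasovskiiReg_eq (g : State n → ℝ → State n) : krasovskiiReg g = reg {∅} g := by
  ext x t q
  simp [krasovskiiReg, reg, ballHull]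

theorem filippovReg_eq (g : State n → ℝ → State n) :
    filippovReg g = reg {N | volume N = 0} g := by
  ext x t q
  simp [filippovReg, reg, ballHull]

theorem isNegligibleFamily_singleton_empty : IsNegligibleFamily ({∅} : Set (Set (State n))) :=
  ⟨⟨∅, rfl⟩, fun s hs => by simpa using hs⟩

theorem isNegligibleFamily_null :
    IsNegligibleFamily ({N | volume N = 0} : Set (Set (State n))) :=
  ⟨⟨∅, measure_empty⟩, fun _ hs => measure_iUnion_null hs⟩

theorem IsNegligibleFamily.union_mem {𝒩 : Set (Set (State n))} (h : IsNegligibleFamily 𝒩)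
    {A B : Set (State n)} (hA : A ∈ 𝒩) (hB : B ∈ 𝒩) : A ∪ B ∈ 𝒩 := by
  have := h.iUnion_mem (fun i => if i = 0 then A else B) (fun i => by
    by_cases hi : i = 0 <;> simp [hi, hA, hB])
  convert this using 1
  ext x
  simp only [mem_union, mem_iUnion]
  constructor
  · rintro (h | h)
    · exact ⟨0, by simpa using h⟩
    · exact ⟨1, by simpa using h⟩
  · rintro ⟨i, hi⟩
    by_cases h0 : i = 0
    · left; simpa [h0] using hi
    · right; simpa [h0] using hi

theorem ballHull_subset {g : State n → ℝ → State n} {δ : ℝ} {N : Set (State n)} {x : State n}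
    {t : ℝ} {C : Set (State n)} (hC : Convex ℝ C) (hC' : IsClosed C)
    (h : ∀ y ∈ Metric.ball x δ \ N, g y t ∈ C) : ballHull g δ N x t ⊆ C :=
  closedConvexHull_min (by rintro _ ⟨y, hy, rfl⟩; exact h y hy) hC hC'

theorem ballHull_mono {g : State n → ℝ → State n} {δ δ' : ℝ} {N N' : Set (State n)}
    {x x' : State n} {t : ℝ} (hd : Metric.ball x δ ⊆ Metric.ball x' δ') (hN : N' ⊆ N) :
    ballHull g δ N x t ⊆ ballHull g δ' N' x' t :=
  (closedConvexHull ℝ).monotone (image_mono (sdiff_subset_sdiff hd hN))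

theorem reg_subset_ballHull {𝒩 : Set (Set (State n))} {g : State n → ℝ → State n} {δ : ℝ}
    (hδ : 0 < δ) {N : Set (State n)} (hN : N ∈ 𝒩) (x : State n) (t : ℝ) :
    reg 𝒩 g x t ⊆ ballHull g δ N x t :=
  fun q hq => by
    simp only [reg, mem_iInter] at hq
    exact hq δ hδ N hN

/-- The hulls of the values of `g` on balls around points of a bounded set are bounded, uniformly in
time, and with them the regularization and the values of sampling maps. -/
theorem exists_ballHull_subset_closedBall {𝒩 : Set (Set (State n))} {t₀ : ℝ}
    {g : State n → ℝ → State n} (hg : LocallyBoundedMod 𝒩 t₀ g) (K : Set (State n))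
    (hK : Bornology.IsBounded K) (δ : ℝ) :
    ∃ M : ℝ, 0 < M ∧ ∀ t, t₀ ≤ t → ∃ N ∈ 𝒩, ∀ x ∈ K,
      ballHull g δ N x t ⊆ Metric.closedBall 0 M := by
  obtain ⟨M, hM, h⟩ := hg _ (hK.isCompact_closure.cthickening (r := δ))
  refine ⟨M, hM, fun t ht => ?_⟩
  obtain ⟨N, hN, h⟩ := h t ht
  refine ⟨N, hN, fun x hx => ballHull_subset (convex_closedBall _ _) Metric.isClosed_closedBall
    fun y hy => ?_⟩
  rw [mem_closedBall_zero_iff]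
  exact h y ⟨Metric.mem_cthickening_of_dist_le y x δ _ (subset_closure hx)
    (Metric.mem_ball.1 hy.1).le, hy.2⟩

/-- By compactness, an upper bound for a linear functional on the regularization of `g` nearly
holds for the values of `g` on a small ball, outside a negligible set. -/
theorem exists_forall_inner_le {𝒩 : Set (Set (State n))} (h𝒩 : IsNegligibleFamily 𝒩) {t₀ : ℝ}
    {g : State n → ℝ → State n} (hg : LocallyBoundedMod 𝒩 t₀ g) {x : State n} {t : ℝ}
    (ht : t₀ ≤ t) (a : State n) {b : ℝ} (hb : ∀ q ∈ reg 𝒩 g x t, inner ℝ a q ≤ b) {ε : ℝ}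
    (hε : 0 < ε) :
    ∃ δ : ℝ, 0 < δ ∧ ∃ N ∈ 𝒩, ∀ y ∈ Metric.ball x δ \ N, inner ℝ a (g y t) ≤ b + ε := by
  obtain ⟨M, -, hM⟩ := exists_ballHull_subset_closedBall hg {x} Bornology.isBounded_singleton 1
  obtain ⟨N₁, hN₁, hM⟩ := hM t ht
  have hS : IsCompact (Metric.closedBall (0 : State n) M ∩ {q | b + ε ≤ inner ℝ a q}) :=
    (isCompact_closedBall _ _).inter_right (isClosed_le (by fun_prop) (by fun_prop))
  let ι := {δ : ℝ // 0 < δ} × {N : Set (State n) // N ∈ 𝒩}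
  have : Nonempty ι := ⟨⟨1, one_pos⟩, ⟨N₁, hN₁⟩⟩
  obtain ⟨⟨δ, N⟩, h⟩ := hS.elim_directed_family_closed
    (fun i : ι => ballHull g i.1 i.2 x t) (fun i => isClosed_closedConvexHull) (by
      ext q
      simp only [mem_inter_iff, mem_iInter, mem_empty_iff_false, iff_false]
      rintro ⟨⟨-, hq⟩, hr⟩
      have : q ∈ reg 𝒩 g x t := by
        simp only [reg, mem_iInter]
        exact fun δ hδ N hN => hr ⟨⟨δ, hδ⟩, ⟨N, hN⟩⟩
      have h1 := hb q this
      simp only [mem_ofPred_eq] at hq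
      linarith) (by
      rintro ⟨⟨δ, hδ⟩, ⟨N, hN⟩⟩ ⟨⟨δ', hδ'⟩, ⟨N', hN'⟩⟩
      exact ⟨⟨⟨min δ δ', lt_min hδ hδ'⟩, ⟨N ∪ N', h𝒩.union_mem hN hN'⟩⟩,
        ballHull_mono (Metric.ball_subset_ball (min_le_left _ _)) subset_union_left,
        ballHull_mono (Metric.ball_subset_ball (min_le_right _ _)) subset_union_right⟩)
  refine ⟨min δ 1, lt_min δ.2 one_pos, N ∪ N₁, h𝒩.union_mem N.2 hN₁, fun y hy => ?_⟩
  by_contra! hlt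
  have hyN : y ∉ (N : Set (State n)) ∧ y ∉ N₁ := by simpa using hy.2
  have h1 : g y t ∈ ballHull g 1 N₁ x t :=
    subset_closedConvexHull ⟨y, ⟨Metric.ball_subset_ball (min_le_right _ _) hy.1, hyN.2⟩, rfl⟩
  have h2 : g y t ∈ ballHull g δ N x t :=
    subset_closedConvexHull ⟨y, ⟨Metric.ball_subset_ball (min_le_left _ _) hy.1, hyN.1⟩, rfl⟩
  exact eq_empty_iff_forall_notMem.1 h _ ⟨⟨hM x rfl h1, hlt.le⟩, h2⟩

/-- Only finitely many modes are active near `(x,t)`, so a half-space that contains the regularized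
modes contains the regularization of the switched field: the latter lies in the closed convex
hull of the former. -/
theorem inner_le_of_mem_reg_switchedField {𝒩 : Set (Set (State n))} (h𝒩 : IsNegligibleFamily 𝒩)
    {t₀ : ℝ} {N₀ : Set ℕ} {f : ℕ → State n → ℝ → State n} {ρ : State n → ℝ → ℕ}
    (hf : ∀ σ ∈ N₀, LocallyBoundedMod 𝒩 t₀ (f σ)) (hρN : ∀ x t, t₀ ≤ t → ρ x t ∈ N₀)
    (hρ : LocallyFiniteSwitching t₀ ρ) {x : State n} {t : ℝ} (ht : t₀ ≤ t) (a : State n) {b : ℝ}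
    (hb : ∀ σ ∈ N₀, ∀ q ∈ reg 𝒩 (f σ) x t, inner ℝ a q ≤ b) {q : State n}
    (hq : q ∈ reg 𝒩 (switchedField f ρ) x t) : inner ℝ a q ≤ b := by
  refine le_of_forall_pos_le_add fun ε hε => ?_
  have key : ∀ σ, ∃ δ : ℝ, 0 < δ ∧ ∃ N ∈ 𝒩, σ ∈ N₀ →
      ∀ y ∈ Metric.ball x δ \ N, inner ℝ a (f σ y t) ≤ b + ε := by
    intro σ
    by_cases hσ : σ ∈ N₀
    · obtain ⟨δ, hδ, N, hN, h⟩ := exists_forall_inner_le h𝒩 (hf σ hσ) ht a (hb σ hσ) hε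
      exact ⟨δ, hδ, N, hN, fun _ => h⟩
    · obtain ⟨N, hN⟩ := h𝒩.nonempty
      exact ⟨1, one_pos, N, hN, fun h => absurd h hσ⟩
  choose d hd N hN h using key
  obtain ⟨δ₀, hδ₀, hfin⟩ := hρ x t ht
  have hev : ∀ᶠ δ in 𝓝[>] (0 : ℝ), ∀ σ ∈ (fun y => ρ y t) '' Metric.ball x δ₀, δ < d σ :=
    (eventually_all_finite hfin).2 fun σ _ => mem_nhdsWithin_of_mem_nhds (Iio_mem_nhds (hd σ))
  obtain ⟨δ, ⟨h1, h2⟩, h3 : 0 < δ⟩ := (hev.and (mem_nhdsWithin_of_mem_nhds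
    (Iio_mem_nhds hδ₀))).and self_mem_nhdsWithin |>.exists
  have hq' := reg_subset_ballHull h3 (h𝒩.iUnion_mem N hN) x t hq
  refine ballHull_subset (C := {q | inner ℝ a q ≤ b + ε}) ?_
    (isClosed_le (by fun_prop) (by fun_prop)) (fun y hy => ?_) hq'
  · exact convex_halfSpace_le (innerₗ (State n) a).isLinear _
  · have hyδ₀ : y ∈ Metric.ball x δ₀ := Metric.ball_subset_ball (le_of_lt h2) hy.1
    refine h (ρ y t) (hρN y t ht) y ⟨?_, fun hc => hy.2 (mem_iUnion.2 ⟨_, hc⟩)⟩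
    exact Metric.ball_subset_ball (h1 _ ⟨y, hyδ₀, rfl⟩).le hy.1

theorem locallyBoundedMod_switchedField {𝒩 : Set (Set (State n))} (h𝒩 : IsNegligibleFamily 𝒩)
    {t₀ : ℝ} {N₀ : Set ℕ} {f : ℕ → State n → ℝ → State n} {ρ : State n → ℝ → ℕ}
    (hf : ∀ K : Set (State n), IsCompact K → ∃ M : ℝ, 0 < M ∧ ∀ σ ∈ N₀, ∀ t, t₀ ≤ t →
      ∃ N ∈ 𝒩, ∀ x ∈ K \ N, ‖f σ x t‖ ≤ M) (hρN : ∀ x t, t₀ ≤ t → ρ x t ∈ N₀) :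
    LocallyBoundedMod 𝒩 t₀ (switchedField f ρ) := by
  intro K hK
  obtain ⟨M, hM, h⟩ := hf K hK
  refine ⟨M, hM, fun t ht => ?_⟩
  have : ∀ σ, ∃ N ∈ 𝒩, σ ∈ N₀ → ∀ x ∈ K \ N, ‖f σ x t‖ ≤ M := by
    intro σ
    by_cases hσ : σ ∈ N₀
    · obtain ⟨N, hN, h⟩ := h σ hσ t ht
      exact ⟨N, hN, fun _ => h⟩
    · obtain ⟨N, hN⟩ := h𝒩.nonempty
      exact ⟨N, hN, fun h => absurd h hσ⟩
  choose N hN h using this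
  exact ⟨_, h𝒩.iUnion_mem N hN, fun x hx => h _ (hρN x t ht) x
    ⟨hx.1, fun hc => hx.2 (mem_iUnion.2 ⟨_, hc⟩)⟩⟩

/-! ### Measurable sampling of the switched field -/

/-- Composition with a measurable choice among countably many measurable maps. -/
theorem aemeasurable_select {α β : Type*} [MeasurableSpace α] [MeasurableSpace β] {μ : Measure α}
    {i : α → ℕ} (hi : AEMeasurable i μ) {S : Set ℕ} (hS : ∀ᵐ a ∂μ, i a ∈ S) {h : ℕ → α → β}
    (hh : ∀ k ∈ S, AEMeasurable (h k) μ) : AEMeasurable (fun a => h (i a) a) μ := by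
  classical
  rcases isEmpty_or_nonempty α with hα | ⟨⟨a₀⟩⟩
  · exact measurable_of_empty _ |>.aemeasurable
  let h' : ℕ → α → β := fun k => if hk : k ∈ S then (hh k hk).mk (h k) else fun _ => h k a₀
  have h'm : ∀ k, Measurable (h' k) := by
    intro k
    by_cases hk : k ∈ S
    · simpa [h', hk] using (hh k hk).measurable_mk
    · simp [h', hk]
  have h'e : ∀ᵐ a ∂μ, ∀ k ∈ S, h k a = h' k a := by
    refine ae_all_iff.2 fun k => ?_
    by_cases hk : k ∈ S
    · filter_upwards [(hh k hk).ae_eq_mk] with a ha _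
      simpa [h', hk] using ha
    · exact Eventually.of_forall fun a hk' => absurd hk' hk
  refine ⟨fun a => h' (hi.mk i a) a, ?_, ?_⟩
  · have : Measurable (fun p : α × ℕ => h' p.2 p.1) :=
      measurable_from_prod_countable_left fun k => h'm k
    exact this.comp (measurable_id.prodMk hi.measurable_mk)
  · filter_upwards [hi.ae_eq_mk, hS, h'e] with a h1 h2 h3
    rw [h3 _ h2, ← h1]

theorem hasSampling_krasovskii {t₀ : ℝ} {N₀ : Set ℕ} {f : ℕ → State n → ℝ → State n}
    {ρ : State n → ℝ → ℕ} (h : KrasovskiiData t₀ N₀ f ρ) :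
    HasSampling {∅} t₀ (switchedField f ρ) := by
  refine ⟨fun _ => switchedField f ρ, fun _ y => ?_, fun k => Eventually.of_forall ?_⟩
  · refine aemeasurable_select (h := fun σ t => f σ y t) (h.measurable_signal y) (S := N₀) ?_
      fun σ hσ => h.measurable_field σ hσ y
    exact (ae_restrict_iff' measurableSet_Ici).2 (Eventually.of_forall fun t ht => h.mode_mem y t ht)
  · intro t _ y δ hδ N hN
    have hδ' : 0 < δ := lt_trans (by positivity) hδ
    rw [mem_singleton_iff.1 hN]
    exact subset_closedConvexHull ⟨y, by simpa using hδ', rfl⟩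

theorem locallyBoundedMod_krasovskii {t₀ : ℝ} {N₀ : Set ℕ} {f : ℕ → State n → ℝ → State n}
    {ρ : State n → ℝ → ℕ} (h : KrasovskiiData t₀ N₀ f ρ) (K : Set (State n)) (hK : IsCompact K) :
    ∃ M : ℝ, 0 < M ∧ ∀ σ ∈ N₀, ∀ t, t₀ ≤ t →
      ∃ N ∈ ({∅} : Set (Set (State n))), ∀ x ∈ K \ N, ‖f σ x t‖ ≤ M := by
  obtain ⟨M, hM, h⟩ := h.locally_bounded K hK
  exact ⟨M, hM, fun σ hσ t ht => ⟨∅, rfl, fun x hx => h σ hσ t ht x hx.1⟩⟩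

theorem locallyBoundedMod_filippov {t₀ : ℝ} {N₀ : Set ℕ} {f : ℕ → State n → ℝ → State n}
    {ρ : State n → ℝ → ℕ} (h : FilippovData t₀ N₀ f ρ) (K : Set (State n)) (hK : IsCompact K) :
    ∃ M : ℝ, 0 < M ∧ ∀ σ ∈ N₀, ∀ t, t₀ ≤ t →
      ∃ N ∈ ({N | volume N = 0} : Set (Set (State n))), ∀ x ∈ K \ N, ‖f σ x t‖ ≤ M := by
  obtain ⟨M, hM, h⟩ := h.locally_ess_bounded K hK
  refine ⟨M, hM, fun σ hσ t ht => ⟨_, h σ hσ t ht, fun x hx => ?_⟩⟩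
  have := hx.2
  simp only [mem_compl_iff, mem_ofPred_eq, not_not] at this
  exact this hx.1

/-- In the Filippov case the sampling maps are averages over balls of radius `1/(k+1)`. -/
theorem hasSampling_filippov {t₀ : ℝ} {N₀ : Set ℕ} {f : ℕ → State n → ℝ → State n}
    {ρ : State n → ℝ → ℕ} (h : FilippovData t₀ N₀ f ρ) :
    HasSampling {N | volume N = 0} t₀ (switchedField f ρ) := by
  set g := switchedField f ρ with hg
  have hgb : LocallyBoundedMod {N | volume N = 0} t₀ g :=
    locallyBoundedMod_switchedField isNegligibleFamily_null (locallyBoundedMod_filippov h)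
      h.mode_mem
  have hprod : (volume.restrict (univ ×ˢ Ici t₀) : Measure (State n × ℝ)) =
      (volume : Measure (State n)).prod (volume.restrict (Ici t₀)) := by
    rw [Measure.volume_eq_prod, ← Measure.prod_restrict, Measure.restrict_univ]
  have hmeas : AEMeasurable (fun p : State n × ℝ => g p.1 p.2)
      ((volume : Measure (State n)).prod (volume.restrict (Ici t₀))) := by
    rw [← hprod]
    refine aemeasurable_select (h := fun σ (p : State n × ℝ) => f σ p.1 p.2) h.measurable_signal
      (S := N₀) ?_ h.measurable_field
    exact (ae_restrict_iff' (MeasurableSet.univ.prod measurableSet_Ici)).2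
      (Eventually.of_forall fun p hp => h.mode_mem _ _ hp.2)
  have hswap : AEStronglyMeasurable (fun p : ℝ × State n => g p.2 p.1)
      ((volume.restrict (Ici t₀)).prod (volume : Measure (State n))) :=
    hmeas.aestronglyMeasurable.prod_swap
  refine ⟨fun k y t => ⨍ z in Metric.ball y (1 / ((k : ℝ) + 1)), g z t, fun k y => ?_,
    fun k => ?_⟩
  · have h1 : AEStronglyMeasurable (fun p : ℝ × State n => g p.2 p.1)
        ((volume.restrict (Ici t₀)).prod
          (volume.restrict (Metric.ball y (1 / ((k : ℝ) + 1))))) := by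
      refine hswap.mono_ac (Measure.AbsolutelyContinuous.prod ?_ ?_)
      · exact Measure.AbsolutelyContinuous.rfl
      · exact Measure.absolutelyContinuous_of_le Measure.restrict_le_self
    have h2 := h1.integral_prod_right'.aemeasurable
    simp only [setAverage_eq]
    exact AEMeasurable.const_smul (M := ℝ) h2 _
  · have h3 := hswap.prodMk_left
    rw [ae_restrict_iff' measurableSet_Ici] at h3
    filter_upwards [h3] with t ht3 ht y δ hδ N hN
    have hr : (0 : ℝ) < 1 / ((k : ℝ) + 1) := by positivity
    refine Convex.set_average_mem convex_closedConvexHull isClosed_closedConvexHull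
      (Metric.measure_ball_pos _ _ hr).ne' measure_ball_lt_top.ne ?_ ?_
    · have hN' : ∀ᵐ z : State n, z ∉ N := measure_eq_zero_iff_ae_notMem.1 hN
      filter_upwards [ae_restrict_of_ae hN', ae_restrict_mem measurableSet_ball] with z hz hz'
      exact subset_closedConvexHull ⟨z, ⟨Metric.ball_subset_ball hδ.le hz', hz⟩, rfl⟩
    · obtain ⟨M, -, hM⟩ := hgb _ (isCompact_closedBall y (1 / ((k : ℝ) + 1)))
      obtain ⟨N', hN', hM⟩ := hM t ht
      refine IntegrableOn.of_bound measure_ball_lt_top (ht3 ht).restrict M ?_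
      have hN'' : ∀ᵐ z : State n, z ∉ N' := measure_eq_zero_iff_ae_notMem.1 hN'
      filter_upwards [ae_restrict_of_ae hN'', ae_restrict_mem measurableSet_ball] with z hz hz'
      exact hM z ⟨Metric.ball_subset_closedBall hz', hz⟩

/-! ### Compactness of trajectories -/

/-- A pointwise bounded sequence of uniformly Lipschitz maps has a pointwise convergent
subsequence: convergence at the points of a dense sequence is arranged by compactness of a
countable product, and the Lipschitz bound propagates it. -/
theorem exists_subseq_tendsto_of_lipschitz {α E : Type*} [PseudoMetricSpace α]
    [TopologicalSpace.SeparableSpace α] [NormedAddCommGroup E] [ProperSpace E] {L : NNReal}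
    {R : ℝ} {X : ℕ → α → E} (hX : ∀ k, LipschitzWith L (X k)) (hR : ∀ k a, ‖X k a‖ ≤ R) :
    ∃ φ : ℕ → ℕ, StrictMono φ ∧ ∃ Y : α → E, ∀ a, Tendsto (fun k => X (φ k) a) atTop (𝓝 (Y a)) := by
  rcases isEmpty_or_nonempty α with hα | hα
  · exact ⟨id, strictMono_id, fun a => hα.elim a, fun a => hα.elim a⟩
  have hc : IsCompact (univ.pi fun _ : ℕ => Metric.closedBall (0 : E) R) :=
    isCompact_univ_pi fun _ => isCompact_closedBall _ _
  obtain ⟨y, -, φ, hφ, hy⟩ := hc.tendsto_subseq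
    (x := fun k i => X k (TopologicalSpace.denseSeq α i)) (fun k i _ => by simpa using hR k _)
  refine ⟨φ, hφ, ?_⟩
  have hcauchy : ∀ a, CauchySeq (fun k => X (φ k) a) := by
    intro a
    refine Metric.cauchySeq_iff.2 fun ε hε => ?_
    have hL : (0 : ℝ) < 3 * (L + 1) := by positivity
    obtain ⟨i, hi⟩ := (TopologicalSpace.denseRange_denseSeq α).exists_dist_lt a
      (div_pos hε hL)
    have hconv : CauchySeq (fun k => X (φ k) (TopologicalSpace.denseSeq α i)) :=
      ((tendsto_pi_nhds.1 hy) i).cauchySeq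
    obtain ⟨m, hm⟩ := Metric.cauchySeq_iff.1 hconv (ε / 3) (by positivity)
    refine ⟨m, fun p hp q hq => ?_⟩
    have h0 := hm p hp q hq
    have hb : (L : ℝ) * dist a (TopologicalSpace.denseSeq α i) < ε / 3 := by
      have : (L + 1 : ℝ) * dist a (TopologicalSpace.denseSeq α i) < ε / 3 := by
        rw [lt_div_iff₀ hL] at hi
        linarith
      nlinarith [dist_nonneg (x := a) (y := TopologicalSpace.denseSeq α i)]
    have h1 := (hX (φ p)).dist_le_mul a (TopologicalSpace.denseSeq α i)
    have h2 := (hX (φ q)).dist_le_mul a (TopologicalSpace.denseSeq α i)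
    have h3 := dist_triangle4 (X (φ p) a) (X (φ p) (TopologicalSpace.denseSeq α i))
      (X (φ q) (TopologicalSpace.denseSeq α i)) (X (φ q) a)
    rw [dist_comm (X (φ q) (TopologicalSpace.denseSeq α i)) (X (φ q) a)] at h3
    linarith
  exact ⟨fun a => (cauchySeq_tendsto_of_complete (hcauchy a)).choose,
    fun a => (cauchySeq_tendsto_of_complete (hcauchy a)).choose_spec⟩

/-- A form of Mazur's lemma: a bounded sequence in a Hilbert space has norm convergent convex
combinations of its tails. Elements of nearly minimal norm in the hulls of the tails form a Cauchy
sequence, by the parallelogram law. -/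
theorem exists_convexHull_tail_tendsto {H : Type*} [NormedAddCommGroup H] [InnerProductSpace ℝ H]
    [CompleteSpace H] {u : ℕ → H} {R : ℝ} (hu : ∀ k, ‖u k‖ ≤ R) :
    ∃ (w : ℕ → H) (l : H), (∀ m, w m ∈ convexHull ℝ (u '' Ici m)) ∧ Tendsto w atTop (𝓝 l) := by
  set A : ℕ → Set ℝ := fun m => (fun z => ‖z‖ ^ 2) '' convexHull ℝ (u '' Ici m) with hA
  have hbdd : ∀ m, BddBelow (A m) := fun m => ⟨0, by rintro _ ⟨z, -, rfl⟩; positivity⟩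
  have hmem : ∀ m, u m ∈ convexHull ℝ (u '' Ici m) := fun m =>
    subset_convexHull ℝ _ ⟨m, self_mem_Ici, rfl⟩
  have hmono : ∀ {m k}, m ≤ k → convexHull ℝ (u '' Ici k) ⊆ convexHull ℝ (u '' Ici m) :=
    fun h => convexHull_mono (image_mono (Ici_subset_Ici.2 h))
  set a : ℕ → ℝ := fun m => sInf (A m) with ha
  have ha_le : ∀ m, ∀ z ∈ convexHull ℝ (u '' Ici m), a m ≤ ‖z‖ ^ 2 := fun m z hz =>
    csInf_le (hbdd m) ⟨z, hz, rfl⟩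
  have ha_mono : Monotone a := fun m k h =>
    csInf_le_csInf (hbdd m) ⟨_, u k, hmem k, rfl⟩ (image_mono (hmono h))
  have ha_bdd : BddAbove (range a) := ⟨R ^ 2, by
    rintro _ ⟨m, rfl⟩
    exact (ha_le m _ (hmem m)).trans (pow_le_pow_left₀ (norm_nonneg _) (hu m) 2)⟩
  have ha_lim := tendsto_atTop_ciSup ha_mono ha_bdd
  set S := ⨆ m, a m
  have haS : ∀ m, a m ≤ S := fun m => le_ciSup ha_bdd m
  have hex : ∀ m, ∃ z ∈ convexHull ℝ (u '' Ici m), ‖z‖ ^ 2 < a m + 1 / ((m : ℝ) + 1) := by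
    intro m
    obtain ⟨_, ⟨z, hz, rfl⟩, h⟩ := exists_lt_of_csInf_lt (s := A m) ⟨_, u m, hmem m, rfl⟩
      (lt_add_of_pos_right (sInf (A m)) (by positivity : (0 : ℝ) < 1 / ((m : ℝ) + 1)))
    exact ⟨z, hz, h⟩
  choose w hw hwlt using hex
  have hcauchy : CauchySeq w := by
    refine cauchySeq_of_le_tendsto_0
      (fun N : ℕ => Real.sqrt (4 * (S - a N) + 4 * (1 / ((N : ℝ) + 1)))) ?_ ?_
    · intro p q N hp hq
      rw [dist_eq_norm]
      refine Real.le_sqrt_of_sq_le ?_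
      have hpar := parallelogram_law_with_norm ℝ (w p) (w q)
      have hmid : (1 / 2 : ℝ) • w p + (1 / 2 : ℝ) • w q ∈ convexHull ℝ (u '' Ici N) :=
        convex_convexHull ℝ _ (hmono hp (hw p)) (hmono hq (hw q)) (by norm_num) (by norm_num)
          (by norm_num)
      have h1 := ha_le N _ hmid
      rw [← smul_add, norm_smul, mul_pow] at h1
      norm_num at h1
      have h2 : ∀ r, N ≤ r → ‖w r‖ ^ 2 ≤ S + 1 / ((N : ℝ) + 1) := by
        intro r hr
        have h3 : 1 / ((r : ℝ) + 1) ≤ 1 / ((N : ℝ) + 1) :=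
          one_div_le_one_div_of_le (by positivity) (by exact_mod_cast Nat.succ_le_succ hr)
        linarith [hwlt r, haS r]
      have h3 := h2 p hp
      have h4 := h2 q hq
      nlinarith
    · have h1 : Tendsto (fun N : ℕ => 4 * (S - a N) + 4 * (1 / ((N : ℝ) + 1))) atTop
          (𝓝 (4 * (S - S) + 4 * 0)) :=
        ((tendsto_const_nhds.sub ha_lim).const_mul 4).add
          (tendsto_one_div_add_atTop_nhds_zero_nat.const_mul 4)
      have h2 := (Real.continuous_sqrt.tendsto _).comp h1
      simpa [Function.comp_def] using h2
  obtain ⟨l, hl⟩ := cauchySeq_tendsto_of_complete hcauchy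
  exact ⟨w, l, hw, hl⟩

/-- Elements of the convex hulls of the tails of a convergent sequence converge to its limit. -/
theorem tendsto_of_mem_convexHull_tail {E : Type*} [NormedAddCommGroup E] [NormedSpace ℝ E]
    {y : ℕ → E} {l : E} (hy : Tendsto y atTop (𝓝 l)) {z : ℕ → E} {ν : ℕ → ℕ}
    (hν : Tendsto ν atTop atTop) (hz : ∀ i, z i ∈ convexHull ℝ (y '' Ici (ν i))) :
    Tendsto z atTop (𝓝 l) := by
  refine Metric.tendsto_atTop.2 fun ε hε => ?_
  obtain ⟨m, hm⟩ := Metric.tendsto_atTop.1 hy ε hε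
  obtain ⟨i₀, hi₀⟩ := (tendsto_atTop_atTop.1 hν) m
  refine ⟨i₀, fun i hi => ?_⟩
  have : convexHull ℝ (y '' Ici (ν i)) ⊆ Metric.ball l ε := by
    refine convexHull_min ?_ (convex_ball _ _)
    rintro _ ⟨k, hk, rfl⟩
    exact hm k ((hi₀ i hi).trans hk)
  exact this (hz i)

/-- If trajectories with bounded velocities `v k` converge pointwise, then the limit is absolutely
continuous, and its velocity belongs at almost every time to each closed convex set that
eventually contains the velocities `v k` at that time. -/
theorem exists_velocity_of_tendsto {a b M : ℝ} {v : ℕ → ℝ → State n}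
    (hv : ∀ k, AEMeasurable (v k) (volume.restrict (Ioc a b)))
    (hM : ∀ k, ∀ᵐ t ∂(volume.restrict (Ioc a b)), ‖v k t‖ ≤ M) {y : ℝ → State n}
    (hy : ∀ t ∈ Icc a b, Tendsto (fun k => ∫ τ in a..t, v k τ) atTop (𝓝 (y t))) :
    ∃ w : ℝ → State n, AEMeasurable w (volume.restrict (Ioc a b)) ∧
      (∀ t ∈ Icc a b, y t = ∫ τ in a..t, w τ) ∧
      ∀ᵐ t ∂(volume.restrict (Ioc a b)), ∀ C : Set (State n), Convex ℝ C → IsClosed C →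
        (∀ᶠ k in atTop, v k t ∈ C) → w t ∈ C := by
  set μ := (volume : Measure ℝ).restrict (Ioc a b) with hμ
  have : IsFiniteMeasure μ := ⟨by simp [hμ]⟩
  have hmem : ∀ k, MemLp (v k) 2 μ := fun k =>
    MemLp.of_bound (hv k).aestronglyMeasurable M (hM k)
  have hLpM : ∀ k, ‖(hmem k).toLp (v k)‖ ≤
      measureUnivNNReal μ ^ (2 : ENNReal).toReal⁻¹ * |M| := fun k =>
    Lp.norm_le_of_ae_bound (abs_nonneg M) (by
      filter_upwards [(hmem k).coeFn_toLp, hM k] with t h1 h2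
      rw [h1]
      exact h2.trans (le_abs_self M))
  obtain ⟨W, l, hW, hWl⟩ := exists_convexHull_tail_tendsto hLpM
  have hWae : ∀ m, ∀ᵐ t ∂μ, W m t ∈ convexHull ℝ ((fun k => v k t) '' Ici m) := by
    intro m
    have hsub : convexHull ℝ ((fun k => (hmem k).toLp (v k)) '' Ici m) ⊆
        {u : Lp (State n) 2 μ | ∀ᵐ t ∂μ, u t ∈ convexHull ℝ ((fun k => v k t) '' Ici m)} := by
      refine convexHull_min ?_ ?_
      · rintro _ ⟨k, hk, rfl⟩
        filter_upwards [(hmem k).coeFn_toLp] with t ht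
        rw [ht]
        exact subset_convexHull ℝ _ ⟨k, hk, rfl⟩
      · intro p hp q hq α β hα hβ hαβ
        filter_upwards [hp, hq, Lp.coeFn_add (α • p) (β • q), Lp.coeFn_smul α p,
          Lp.coeFn_smul β q] with t h1 h2 h3 h4 h5
        rw [h3, Pi.add_apply, h4, h5]
        exact convex_convexHull ℝ _ h1 h2 hα hβ hαβ
    exact hsub (hW m)
  have hint : ∀ (u : Lp (State n) 2 μ), Integrable u μ := fun u =>
    (Lp.memLp u).integrable one_le_two
  have hμt : ∀ t ∈ Icc a b, μ.restrict (Ioc a t) = volume.restrict (Ioc a t) := by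
    intro t ht
    rw [hμ, Measure.restrict_restrict measurableSet_Ioc,
      inter_eq_left.2 (Ioc_subset_Ioc_right ht.2)]
  have hWint : ∀ m, ∀ t ∈ Icc a b, (∫ τ in a..t, W m τ) ∈
      convexHull ℝ ((fun k => ∫ τ in a..t, v k τ) '' Ici m) := by
    intro m t ht
    have hsub : convexHull ℝ ((fun k => (hmem k).toLp (v k)) '' Ici m) ⊆
        {u : Lp (State n) 2 μ | (∫ τ in a..t, u τ) ∈
          convexHull ℝ ((fun k => ∫ τ in a..t, v k τ) '' Ici m)} := by
      simp only [intervalIntegral.integral_of_le ht.1, ← hμt t ht]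
      refine convexHull_min ?_ ?_
      · rintro _ ⟨k, hk, rfl⟩
        refine subset_convexHull ℝ _ ⟨k, hk, ?_⟩
        exact integral_congr_ae (ae_restrict_of_ae (hmem k).coeFn_toLp.symm)
      · intro p hp q hq α β hα hβ hαβ
        have : (∫ τ in Ioc a t, (α • p + β • q : Lp (State n) 2 μ) τ ∂μ) =
            α • (∫ τ in Ioc a t, p τ ∂μ) + β • ∫ τ in Ioc a t, q τ ∂μ := by
          rw [← integral_smul, ← integral_smul, ← integral_add
            ((hint p).restrict.fun_smul α) ((hint q).restrict.fun_smul β)]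
          refine integral_congr_ae (ae_restrict_of_ae ?_)
          filter_upwards [Lp.coeFn_add (α • p) (β • q), Lp.coeFn_smul α p,
            Lp.coeFn_smul β q] with t h3 h4 h5
          rw [h3, Pi.add_apply, h4, h5]
          simp only [Pi.smul_apply]
        rw [mem_ofPred_eq, this]
        exact convex_convexHull ℝ _ hp hq hα hβ hαβ
    exact hsub (hW m)
  obtain ⟨ν, hν, hνl⟩ := (tendstoInMeasure_of_tendsto_Lp hWl).exists_seq_tendsto_ae
  refine ⟨l, (Lp.aestronglyMeasurable l).aemeasurable, fun t ht => ?_, ?_⟩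
  · have h1 : Tendsto (fun i => ∫ τ in a..t, W (ν i) τ) atTop (𝓝 (y t)) :=
      tendsto_of_mem_convexHull_tail (hy t ht) hν.tendsto_atTop fun i => hWint (ν i) t ht
    have h2 : Tendsto (fun i => ∫ τ in a..t, W (ν i) τ) atTop (𝓝 (∫ τ in a..t, l τ)) := by
      simp only [intervalIntegral.integral_of_le ht.1, ← hμt t ht]
      refine tendsto_integral_of_dominated_convergence (fun _ => M)
        (fun i => (Lp.aestronglyMeasurable _).restrict) (integrable_const _) (fun i => ?_)
        (ae_restrict_of_ae hνl)
      refine ae_restrict_of_ae ?_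
      filter_upwards [hWae (ν i), ae_all_iff.2 hM] with τ h1 h2
      rw [← mem_closedBall_zero_iff]
      refine convexHull_min ?_ (convex_closedBall _ _) h1
      rintro _ ⟨k, -, rfl⟩
      exact mem_closedBall_zero_iff.2 (h2 k)
    exact tendsto_nhds_unique h1 h2
  · filter_upwards [hνl, ae_all_iff.2 hWae] with t h1 h2 C hC hC' hev
    obtain ⟨k₀, hk₀⟩ := eventually_atTop.1 hev
    refine hC'.mem_of_tendsto h1 ?_
    filter_upwards [hν.tendsto_atTop.eventually_ge_atTop k₀] with i hi
    refine convexHull_min ?_ hC (h2 (ν i))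
    rintro _ ⟨k, hk, rfl⟩
    exact hk₀ k (hi.trans hk)

/-! ### Local existence of solutions -/

/-- The nodes of the Euler polygon with step `η` from `(a, x₁)` for `ẋ = s(x,t)`: each step
integrates `s` in time with the state frozen at the last node. -/
noncomputable def eulerNode (s : State n → ℝ → State n) (a η : ℝ) (x₁ : State n) : ℕ → State n
  | 0 => x₁
  | i + 1 => eulerNode s a η x₁ i +
      ∫ τ in (a + i * η)..(a + (i + 1 : ℕ) * η), s (eulerNode s a η x₁ i) τ

/-- The velocity of the Euler polygon. -/
noncomputable def eulerVelocity (s : State n → ℝ → State n) (a η : ℝ) (x₁ : State n) (t : ℝ) :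
    State n :=
  s (eulerNode s a η x₁ ⌊(t - a) / η⌋₊) t

theorem aemeasurable_eulerVelocity {s : State n → ℝ → State n} {a η : ℝ} (x₁ : State n)
    (hs : ∀ y, AEMeasurable (s y) (volume.restrict (Ici a))) :
    AEMeasurable (eulerVelocity s a η x₁) (volume.restrict (Ici a)) := by
  refine aemeasurable_select (i := fun t => ⌊(t - a) / η⌋₊) (S := univ)
    (h := fun i t => s (eulerNode s a η x₁ i) t) ?_ (Eventually.of_forall fun _ => mem_univ _)
    fun i _ => hs _
  exact (Nat.measurable_floor.comp ((measurable_id.sub_const a).div_const η)).aemeasurable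

theorem intervalIntegrable_of_ae_bound {a M : ℝ} {v : ℝ → State n}
    (hv : AEMeasurable v (volume.restrict (Ici a))) (hM : ∀ᵐ t : ℝ, a ≤ t → ‖v t‖ ≤ M) {b c : ℝ}
    (hb : a ≤ b) (hc : a ≤ c) : IntervalIntegrable v volume b c := by
  have hsub : uIoc b c ⊆ Ici a := fun t ht => (le_min hb hc).trans ht.1.le
  rw [intervalIntegrable_iff]
  refine IntegrableOn.of_bound (by simp [uIoc]) ?_ M ?_
  · exact (hv.mono_measure (Measure.restrict_mono hsub le_rfl)).aestronglyMeasurable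
  · rw [ae_restrict_iff' measurableSet_uIoc]
    filter_upwards [hM] with t ht h
    exact ht (hsub h)

theorem dist_integral_le_of_ae_bound {a M : ℝ} {v : ℝ → State n}
    (hv : AEMeasurable v (volume.restrict (Ici a))) (hM : ∀ᵐ t : ℝ, a ≤ t → ‖v t‖ ≤ M) {b c : ℝ}
    (hb : a ≤ b) (hc : a ≤ c) :
    dist (∫ τ in a..b, v τ) (∫ τ in a..c, v τ) ≤ M * |b - c| := by
  rw [dist_eq_norm, intervalIntegral.integral_interval_sub_left
    (intervalIntegrable_of_ae_bound hv hM le_rfl hb)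
    (intervalIntegrable_of_ae_bound hv hM le_rfl hc)]
  refine intervalIntegral.norm_integral_le_of_norm_le_const_ae ?_
  filter_upwards [hM] with t ht h
  exact ht ((le_min hc hb).trans h.1.le)

/-- The Euler polygon, written as an integral of its velocity, passes through its nodes. -/
theorem eulerNode_eq {s : State n → ℝ → State n} {a η M : ℝ} (hη : 0 < η) (x₁ : State n)
    (hs : ∀ y, AEMeasurable (s y) (volume.restrict (Ici a)))
    (hM : ∀ᵐ t : ℝ, a ≤ t → ∀ y, ‖s y t‖ ≤ M) (i : ℕ) :
    eulerNode s a η x₁ i = x₁ + ∫ τ in a..(a + i * η), eulerVelocity s a η x₁ τ := by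
  have hv := aemeasurable_eulerVelocity (η := η) x₁ hs
  have hvM : ∀ᵐ t : ℝ, a ≤ t → ‖eulerVelocity s a η x₁ t‖ ≤ M := by
    filter_upwards [hM] with t ht h using ht h _
  induction i with
  | zero => simp [eulerNode]
  | succ i ih =>
    have h1 : a ≤ a + i * η := le_add_of_nonneg_right (by positivity)
    have h2 : a + i * η ≤ a + (i + 1 : ℕ) * η := by push_cast; linarith
    rw [← intervalIntegral.integral_add_adjacent_intervals
      (intervalIntegrable_of_ae_bound hv hvM le_rfl h1)
      (intervalIntegrable_of_ae_bound hv hvM h1 (h1.trans h2)), ← add_assoc, ← ih, eulerNode]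
    congr 1
    refine intervalIntegral.integral_congr_ae ?_
    have hne : ∀ᵐ t : ℝ, t ≠ a + (i + 1 : ℕ) * η := by simp [ae_iff, measure_singleton]
    filter_upwards [hne] with t ht hmem
    rw [uIoc_of_le h2] at hmem
    have hfl : ⌊(t - a) / η⌋₊ = i := by
      have hlt := lt_of_le_of_ne hmem.2 ht
      push_cast at hlt
      rw [Nat.floor_eq_iff (div_nonneg (by linarith [hmem.1]) hη.le), le_div_iff₀ hη,
        div_lt_iff₀ hη]
      exact ⟨by linarith [hmem.1], by linarith⟩
    rw [eulerVelocity, hfl]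

/-- From every initial state and time there starts a Lipschitz curve that satisfies the
differential inclusion. It is the limit of Euler polygons of the sampling maps. -/
theorem exists_local_trajectory {𝒩 : Set (Set (State n))} {t₀ : ℝ} {g : State n → ℝ → State n}
    (hg : LocallyBoundedMod 𝒩 t₀ g) (hs : HasSampling 𝒩 t₀ g) {a : ℝ} (ha : t₀ ≤ a)
    (x₁ : State n) :
    ∃ h : ℝ, 0 < h ∧ ∃ x : ℝ → State n, x a = x₁ ∧
      (∃ L : NNReal, LipschitzOnWith L x (Icc a (a + h))) ∧
      ∀ᵐ t : ℝ, t ∈ Ioo a (a + h) → ∃ q ∈ reg 𝒩 g (x t) t, HasDerivAt x q t := by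
  classical
  obtain ⟨s, hsm, hsg⟩ := hs
  set K := Metric.closedBall x₁ 1 with hK
  obtain ⟨M, hM, hb⟩ := exists_ballHull_subset_closedBall hg K Metric.isBounded_closedBall 2
  -- A trajectory of speed at most `M` needs the time `1 / M` to leave the ball `K`.
  set h : ℝ := 1 / M with hh
  have hh0 : 0 < h := by positivity
  have hMh : M * h = 1 := by rw [hh]; field_simp
  -- Outside `K` the sampling maps are replaced by zero, which makes them globally bounded.
  set s' : ℕ → State n → ℝ → State n := fun k y t => if y ∈ K then s k y t else 0 with hs'
  have hs'm : ∀ k y, AEMeasurable (s' k y) (volume.restrict (Ici a)) := by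
    intro k y
    by_cases hy : y ∈ K
    · simpa [hs', hy] using!
        (hsm k y).mono_measure (Measure.restrict_mono (Ici_subset_Ici.2 ha) le_rfl)
    · simp [hs', hy]
  have hs'M : ∀ k, ∀ᵐ t : ℝ, a ≤ t → ∀ y, ‖s' k y t‖ ≤ M := by
    intro k
    filter_upwards [hsg k] with t ht hat y
    by_cases hy : y ∈ K
    · obtain ⟨N, hN, hb⟩ := hb t (ha.trans hat)
      have hk : 1 / ((k : ℝ) + 1) < 2 := by
        have : 1 / ((k : ℝ) + 1) ≤ 1 := by
          rw [div_le_one (by positivity)]; linarith [(Nat.cast_nonneg k : (0 : ℝ) ≤ k)]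
        linarith
      simpa [hs', hy] using hb y hy (ht (ha.trans hat) y 2 hk N hN)
    · simpa [hs', hy] using hM.le
  set η : ℕ → ℝ := fun k => h / ((k : ℝ) + 1) with hη
  have hη0 : ∀ k, 0 < η k := fun k => by positivity
  set v : ℕ → ℝ → State n := fun k => eulerVelocity (s' k) a (η k) x₁ with hv
  have hvm : ∀ k, AEMeasurable (v k) (volume.restrict (Ici a)) := fun k =>
    aemeasurable_eulerVelocity x₁ (hs'm k)
  have hvM : ∀ k, ∀ᵐ t : ℝ, a ≤ t → ‖v k t‖ ≤ M := fun k => by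
    filter_upwards [hs'M k] with t ht h using ht h _
  set X : ℕ → ℝ → State n := fun k t => ∫ τ in a..t, v k τ with hX
  have hXL : ∀ k, ∀ b c, a ≤ b → a ≤ c → dist (X k b) (X k c) ≤ M * |b - c| :=
    fun k b c hb hc => dist_integral_le_of_ae_bound (hvm k) (hvM k) hb hc
  have hX0 : ∀ k, X k a = 0 := fun k => by simp [hX]
  have hXb : ∀ k, ∀ t ∈ Icc a (a + h), ‖X k t‖ ≤ 1 := by
    intro k t ht
    have h1 := hXL k t a ht.1 le_rfl
    rw [hX0, dist_zero_right, abs_of_nonneg (by linarith [ht.1])] at h1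
    nlinarith [ht.2]
  obtain ⟨φ, hφ, Y, hY⟩ := exists_subseq_tendsto_of_lipschitz (α := Icc a (a + h))
    (L := M.toNNReal) (R := 1) (X := fun k t => X k t)
    (fun k => LipschitzWith.of_dist_le_mul fun b c => by
      simpa [hM.le, Real.dist_eq, Subtype.dist_eq] using hXL k b c b.2.1 c.2.1)
    (fun k t => hXb k t t.2)
  have hsub : Ioc a (a + h) ⊆ Ici a := fun t ht => ht.1.le
  have hvM' : ∀ k, ∀ᵐ t ∂(volume.restrict (Ioc a (a + h))), ‖v k t‖ ≤ M := fun k =>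
    (ae_restrict_iff' measurableSet_Ioc).2 (by
      filter_upwards [hvM k] with t ht h using ht h.1.le)
  obtain ⟨w, hwm, hwY, hwC⟩ := exists_velocity_of_tendsto (a := a) (b := a + h) (M := M)
    (v := fun k => v (φ k)) (y := fun t => if ht : t ∈ Icc a (a + h) then Y ⟨t, ht⟩ else 0)
    (fun k => (hvm _).mono_measure (Measure.restrict_mono hsub le_rfl))
    (fun k => hvM' _) (fun t ht => by simpa [ht] using hY ⟨t, ht⟩)
  have hwM : ∀ᵐ t ∂(volume.restrict (Ioc a (a + h))), ‖w t‖ ≤ M := by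
    filter_upwards [hwC, ae_all_iff.2 hvM'] with t h1 h2
    simpa using h1 (Metric.closedBall 0 M) (convex_closedBall _ _) Metric.isClosed_closedBall
      (Eventually.of_forall fun k => by simpa using h2 (φ k))
  have hwint : IntervalIntegrable w volume a (a + h) := by
    rw [intervalIntegrable_iff_integrableOn_Ioc_of_le (by linarith)]
    exact IntegrableOn.of_bound (by simp) hwm.aestronglyMeasurable M hwM
  set x : ℝ → State n := fun t => x₁ + ∫ τ in a..t, w τ with hx
  have hxlim : ∀ t ∈ Icc a (a + h), Tendsto (fun k => x₁ + X (φ k) t) atTop (𝓝 (x t)) := by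
    intro t ht
    have h1 := hwY t ht
    simp only [ht, dite_true] at h1
    simp only [hx]
    rw [← h1]
    exact (hY ⟨t, ht⟩).const_add x₁
  refine ⟨h, hh0, x, by simp [hx], ⟨M.toNNReal, LipschitzOnWith.of_dist_le_mul ?_⟩, ?_⟩
  · intro b hb c hc
    refine le_of_tendsto ((hxlim b hb).dist (hxlim c hc)) (Eventually.of_forall fun k => ?_)
    simpa [hM.le, Real.dist_eq] using hXL (φ k) b c hb.1 hc.1
  · rw [ae_restrict_iff' measurableSet_Ioc] at hwC
    filter_upwards [hwC, ae_all_iff.2 hsg, hwint.ae_hasDerivAt_integral] with t h1 h2 h3 ht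
    have htI : t ∈ Icc a (a + h) := Ioo_subset_Icc_self ht
    have hmem : t ∈ uIcc a (a + h) := by rwa [uIcc_of_le (by linarith)]
    refine ⟨w t, ?_, (h3 hmem a left_mem_uIcc).const_add x₁⟩
    simp only [reg, mem_iInter]
    intro δ hδ N hN
    refine h1 (Ioo_subset_Ioc_self ht) _ convex_closedConvexHull isClosed_closedConvexHull ?_
    have hk0 : Tendsto (fun k => 1 / ((φ k : ℝ) + 1)) atTop (𝓝 0) :=
      tendsto_one_div_add_atTop_nhds_zero_nat.comp hφ.tendsto_atTop
    have hη0' : Tendsto (fun k => M * η (φ k)) atTop (𝓝 0) := by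
      have : (fun k => M * η (φ k)) = fun k => 1 / ((φ k : ℝ) + 1) := by
        funext k
        rw [hη, ← mul_div_assoc, hMh]
      rwa [this]
    filter_upwards [hk0.eventually_lt_const (half_pos hδ),
      hη0'.eventually_lt_const (by positivity : (0 : ℝ) < δ / 4),
      (hxlim t htI).eventually (Metric.ball_mem_nhds _ (by positivity : (0 : ℝ) < δ / 4))]
      with k hk1 hk2 hk3
    set i := ⌊(t - a) / η (φ k)⌋₊ with hi
    set node := eulerNode (s' (φ k)) a (η (φ k)) x₁ i with hnode
    have hnode_eq : node = x₁ + X (φ k) (a + i * η (φ k)) :=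
      eulerNode_eq (hη0 _) x₁ (hs'm _) (hs'M _) i
    have hpos := hη0 (φ k)
    have hfl1 : i * η (φ k) ≤ t - a := by
      rw [← le_div_iff₀ hpos]
      exact Nat.floor_le (div_nonneg (by linarith [ht.1]) hpos.le)
    have hfl2 : t - a < (i + 1) * η (φ k) := by
      rw [← div_lt_iff₀ hpos]
      exact Nat.lt_floor_add_one _
    have hi0 : 0 ≤ i * η (φ k) := by positivity
    have hnodeI : a + i * η (φ k) ∈ Icc a (a + h) :=
      ⟨by linarith, by linarith [ht.2]⟩
    have hnodeK : node ∈ K := by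
      rw [hK, mem_closedBall_iff_norm, hnode_eq, add_sub_cancel_left]
      exact hXb _ _ hnodeI
    have hd : dist node (x₁ + X (φ k) t) ≤ M * η (φ k) := by
      rw [hnode_eq, dist_add_left]
      refine (hXL _ _ _ hnodeI.1 htI.1).trans (mul_le_mul_of_nonneg_left ?_ hM.le)
      rw [abs_le]
      constructor <;> linarith
    have hd' : dist node (x t) < δ / 2 := by
      have := dist_triangle node (x₁ + X (φ k) t) (x t)
      have h5 : dist (x₁ + X (φ k) t) (x t) < δ / 4 := hk3
      linarith
    have hvk : v (φ k) t = s (φ k) node t := by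
      simp only [hv, eulerVelocity, hs']
      rw [if_pos hnodeK]
    rw [hvk]
    refine ballHull_mono ?_ subset_rfl (h2 (φ k) (ha.trans htI.1) node (δ / 2) hk1 N hN)
    exact Metric.ball_subset_ball' (by linarith)

/-! ### Extension of solutions -/

theorem absolutelyContinuousOnInterval_of_dist_le {X Y : Type*} [PseudoMetricSpace X]
    [PseudoMetricSpace Y] {f : ℝ → X} {g : ℝ → Y} {a b C : ℝ}
    (hg : AbsolutelyContinuousOnInterval g a b)
    (h : ∀ s ∈ uIcc a b, ∀ t ∈ uIcc a b, dist (f s) (f t) ≤ C * dist (g s) (g t)) :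
    AbsolutelyContinuousOnInterval f a b := by
  refine squeeze_zero' (Eventually.of_forall fun E => Finset.sum_nonneg fun _ _ => dist_nonneg) ?_
    (by simpa using Tendsto.const_mul C hg)
  filter_upwards [mem_inf_of_right (mem_principal_self _)] with E hE
  rw [Finset.mul_sum]
  exact Finset.sum_le_sum fun i hi => h _ (hE.1 i hi).1 _ (hE.1 i hi).2

theorem ae_mem_nhds_of_ordConnected {I : Set ℝ} (hI : I.OrdConnected) :
    ∀ᵐ t : ℝ, t ∈ I → I ∈ 𝓝 t := by
  have h := hI.convex.addHaar_frontier (μ := (volume : Measure ℝ))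
  filter_upwards [measure_eq_zero_iff_ae_notMem.1 h] with t ht htI
  rw [← mem_interior_iff_mem_nhds]
  by_contra hc
  exact ht ⟨subset_closure htI, hc⟩

theorem IsSolution.ae_hasDerivAt {F : State n → ℝ → Set (State n)} {t₀ : ℝ} {x : ℝ → State n}
    {I : Set ℝ} (hx : IsSolution F t₀ x I) :
    ∀ᵐ t : ℝ, t ∈ I → ∃ q ∈ F (x t) t, HasDerivAt x q t := by
  filter_upwards [hx.inclusion, ae_mem_nhds_of_ordConnected hx.ordConnected] with t h1 h2 ht
  obtain ⟨q, hq, hd⟩ := h1 ht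
  exact ⟨q, hq, hd.hasDerivAt (h2 ht)⟩

theorem IsSolution.restrict {F : State n → ℝ → Set (State n)} {t₀ : ℝ} {x : ℝ → State n}
    {I J : Set ℝ} (hx : IsSolution F t₀ x I) (hJI : J ⊆ I) (hJ : J.OrdConnected)
    (hJn : J.Nontrivial) (hJl : IsLeast J t₀) : IsSolution F t₀ x J where
  ordConnected := hJ
  nontrivial := hJn
  isLeast := hJl
  absolutelyContinuous a ha b hb := hx.absolutelyContinuous a (hJI ha) b (hJI hb)
  inclusion := by
    filter_upwards [hx.inclusion] with t ht htJ
    obtain ⟨q, hq, hd⟩ := ht (hJI htJ)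
    exact ⟨q, hq, hd.mono hJI⟩

theorem IsSolution.continuousOn {F : State n → ℝ → Set (State n)} {t₀ : ℝ} {x : ℝ → State n}
    {I : Set ℝ} (hx : IsSolution F t₀ x I) {T : ℝ} (hT : T ∈ I) : ContinuousOn x (Icc t₀ T) := by
  have := (hx.absolutelyContinuous t₀ hx.isLeast.1 T hT).continuousOn
  rwa [uIcc_of_le (hx.isLeast.2 hT)] at this

/-- A solution with velocities bounded by `M` is `M`-Lipschitz: compare along the direction of the
increment. -/
theorem IsSolution.dist_le {F : State n → ℝ → Set (State n)} {t₀ : ℝ} {x : ℝ → State n}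
    {I : Set ℝ} (hx : IsSolution F t₀ x I) {M : ℝ} (hM0 : 0 ≤ M)
    (hM : ∀ t ∈ I, ∀ q ∈ F (x t) t, ‖q‖ ≤ M) {s t : ℝ} (hs : s ∈ I) (ht : t ∈ I) :
    dist (x s) (x t) ≤ M * |s - t| := by
  set u := x t - x s with hu
  have hac : AbsolutelyContinuousOnInterval (fun τ => inner ℝ u (x τ)) s t := by
    refine absolutelyContinuousOnInterval_of_dist_le (C := ‖u‖)
      (hx.absolutelyContinuous s hs t ht) fun a _ b _ => ?_
    rw [Real.dist_eq, ← inner_sub_right, dist_eq_norm]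
    exact abs_real_inner_le_norm _ _
  have hint := hac.integral_deriv_eq_sub
  rw [← inner_sub_right, ← hu, real_inner_self_eq_norm_sq] at hint
  have hbound : ‖∫ τ in s..t, deriv (fun τ => inner ℝ u (x τ)) τ‖ ≤ (‖u‖ * M) * |t - s| := by
    refine intervalIntegral.norm_integral_le_of_norm_le_const_ae ?_
    filter_upwards [hx.ae_hasDerivAt] with τ hτ hτst
    have hτI : τ ∈ I := hx.ordConnected.uIcc_subset hs ht (uIoc_subset_uIcc hτst)
    obtain ⟨q, hq, hd⟩ := hτ hτI
    have hd' : HasDerivAt (fun τ => inner ℝ u (x τ)) (inner ℝ u q) τ := by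
      simpa using (hasDerivAt_const τ u).inner ℝ hd
    rw [hd'.deriv]
    exact (norm_inner_le_norm _ _).trans
      (mul_le_mul_of_nonneg_left (hM τ hτI q hq) (norm_nonneg _))
  rw [hint, Real.norm_eq_abs, abs_of_nonneg (by positivity)] at hbound
  rw [dist_comm, dist_eq_norm, ← hu, abs_sub_comm]
  rcases (norm_nonneg u).eq_or_lt with h0 | h0
  · rw [← h0]; positivity
  · nlinarith

/-- The union of a chain of solutions, ordered by extension, is a solution. -/
theorem exists_isSolution_of_chain {F : State n → ℝ → Set (State n)} {t₀ : ℝ}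
    {c : Set ((ℝ → State n) × Set ℝ)} (hne : c.Nonempty) (hsol : ∀ p ∈ c, IsSolution F t₀ p.1 p.2)
    (hc : IsChain (fun p q => p.2 ⊆ q.2 ∧ EqOn p.1 q.1 p.2) c) :
    ∃ z : (ℝ → State n) × Set ℝ, IsSolution F t₀ z.1 z.2 ∧
      ∀ p ∈ c, p.2 ⊆ z.2 ∧ EqOn p.1 z.1 p.2 := by
  classical
  set J : Set ℝ := ⋃ p ∈ c, p.2 with hJ
  have hJmem : ∀ t, t ∈ J ↔ ∃ p ∈ c, t ∈ p.2 := by simp [hJ]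
  set z : ℝ → State n := fun t => if h : ∃ p ∈ c, t ∈ p.2 then h.choose.1 t else 0 with hz
  have hzeq : ∀ p ∈ c, EqOn p.1 z p.2 := by
    intro p hp t ht
    have h : ∃ p ∈ c, t ∈ p.2 := ⟨p, hp, ht⟩
    have hz' : z t = h.choose.1 t := by simp only [hz]; rw [dif_pos h]
    rw [hz']
    rcases eq_or_ne p h.choose with he | he
    · rw [← he]
    · rcases hc hp h.choose_spec.1 he with h1 | h1
      · exact h1.2 ht
      · exact (h1.2 h.choose_spec.2).symm
  have hpJ : ∀ p ∈ c, p.2 ⊆ J := fun p hp t ht => (hJmem t).2 ⟨p, hp, ht⟩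
  have hpair : ∀ a ∈ J, ∀ b ∈ J, ∃ p ∈ c, a ∈ p.2 ∧ b ∈ p.2 := by
    intro a ha b hb
    obtain ⟨p, hp, hap⟩ := (hJmem a).1 ha
    obtain ⟨q, hq, hbq⟩ := (hJmem b).1 hb
    rcases eq_or_ne p q with rfl | he
    · exact ⟨p, hp, hap, hbq⟩
    · rcases hc hp hq he with h1 | h1
      · exact ⟨q, hq, h1.1 hap, hbq⟩
      · exact ⟨p, hp, hap, h1.1 hbq⟩
  obtain ⟨p₀, hp₀⟩ := hne
  have hJoc : J.OrdConnected := ⟨fun a ha b hb t ht => by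
    obtain ⟨p, hp, hap, hbp⟩ := hpair a ha b hb
    exact hpJ p hp ((hsol p hp).ordConnected.out hap hbp ht)⟩
  have hJl : IsLeast J t₀ := ⟨hpJ p₀ hp₀ (hsol p₀ hp₀).isLeast.1, fun t ht => by
    obtain ⟨p, hp, htp⟩ := (hJmem t).1 ht
    exact (hsol p hp).isLeast.2 htp⟩
  refine ⟨⟨z, J⟩, ⟨hJoc, (hsol p₀ hp₀).nontrivial.mono (hpJ p₀ hp₀), hJl, ?_, ?_⟩,
    fun p hp => ⟨hpJ p hp, hzeq p hp⟩⟩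
  · intro a ha b hb
    obtain ⟨p, hp, hap, hbp⟩ := hpair a ha b hb
    refine absolutelyContinuousOnInterval_of_dist_le (C := 1)
      ((hsol p hp).absolutelyContinuous a hap b hbp) fun s hs t ht => ?_
    have hsub := (hsol p hp).ordConnected.uIcc_subset hap hbp
    rw [hzeq p hp (hsub hs), hzeq p hp (hsub ht), one_mul]
  · -- The exceptional set is null because rational endpoints select countably many solutions.
    have hq : ∀ r : ℚ, ∃ p ∈ c, (r : ℝ) ∈ J → (r : ℝ) ∈ p.2 := by
      intro r
      by_cases hr : (r : ℝ) ∈ J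
      · obtain ⟨p, hp, h⟩ := (hJmem _).1 hr
        exact ⟨p, hp, fun _ => h⟩
      · exact ⟨p₀, hp₀, fun h => absurd h hr⟩
    choose P hP hPm using hq
    have hall : ∀ᵐ t : ℝ, ∀ r : ℚ, t ∈ (P r).2 → ∃ q ∈ F ((P r).1 t) t, HasDerivAt (P r).1 q t :=
      ae_all_iff.2 fun r => (hsol _ (hP r)).ae_hasDerivAt
    filter_upwards [hall, ae_mem_nhds_of_ordConnected hJoc] with t h1 h2 ht
    obtain ⟨l, u, htlu, hlu⟩ := mem_nhds_iff_exists_Ioo_subset.1 (h2 ht)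
    obtain ⟨r, hr1, hr2⟩ := exists_rat_btwn htlu.2
    have hrP := hPm r (hlu ⟨htlu.1.trans hr1, hr2⟩)
    have ht₀ : t₀ < t := by
      obtain ⟨m, hm1, hm2⟩ := exists_between htlu.1
      exact (hJl.2 (hlu ⟨hm1, hm2.trans htlu.2⟩)).trans_lt hm2
    have hsub : Icc t₀ (r : ℝ) ⊆ (P r).2 :=
      (hsol _ (hP r)).ordConnected.out (hsol _ (hP r)).isLeast.1 hrP
    have hnhds : (P r).2 ∈ 𝓝 t := mem_of_superset (Icc_mem_nhds ht₀ hr1) hsub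
    obtain ⟨q, hq, hd⟩ := h1 r (mem_of_mem_nhds hnhds)
    have heq : z =ᶠ[𝓝 t] (P r).1 := by
      filter_upwards [hnhds] with τ hτ using (hzeq _ (hP r) hτ).symm
    refine ⟨q, ?_, (hd.congr_of_eventuallyEq heq).hasDerivWithinAt⟩
    rw [← hzeq _ (hP r) (mem_of_mem_nhds hnhds)]
    exact hq

/-- Every solution extends to a maximal one, by Zorn's lemma. -/
theorem IsSolution.exists_maximal {F : State n → ℝ → Set (State n)} {t₀ : ℝ} {x : ℝ → State n}
    {I : Set ℝ} (hx : IsSolution F t₀ x I) :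
    ∃ (y : ℝ → State n) (J : Set ℝ), IsMaximalSolution F t₀ y J ∧ I ⊆ J ∧ EqOn x y I := by
  let α := {p : (ℝ → State n) × Set ℝ // IsSolution F t₀ p.1 p.2 ∧ I ⊆ p.2 ∧ EqOn x p.1 I}
  let r : α → α → Prop := fun p q => p.1.2 ⊆ q.1.2 ∧ EqOn p.1.1 q.1.1 p.1.2
  have : Nonempty α := ⟨⟨(x, I), hx, subset_rfl, eqOn_refl _ _⟩⟩
  obtain ⟨⟨m, hm, hIm, hxm⟩, hmax⟩ := exists_maximal_of_nonempty_chains_bounded (r := r) (by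
    intro c hc hne
    obtain ⟨z, hz, hub⟩ := exists_isSolution_of_chain (c := Subtype.val '' c) (hne.image _)
      (by rintro _ ⟨p, -, rfl⟩; exact p.2.1)
      (by
        rintro _ ⟨p, hp, rfl⟩ _ ⟨q, hq, rfl⟩ hne
        exact hc hp hq fun h => hne (congrArg _ h))
    obtain ⟨p, hp⟩ := hne
    have hpz := hub p ⟨p, hp, rfl⟩
    refine ⟨⟨z, hz, p.2.2.1.trans hpz.1, p.2.2.2.trans (hpz.2.mono p.2.2.1)⟩, fun q hq => ?_⟩
    exact hub q ⟨q, hq, rfl⟩)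
    (fun h1 h2 => ⟨h1.1.trans h2.1, h1.2.trans (h2.2.mono h1.1)⟩)
  refine ⟨m.1, m.2, ⟨hm, fun y J hy hJ hEq => ?_⟩, hIm, hxm⟩
  exact (hmax ⟨(y, J), hy, hIm.trans hJ, hxm.trans (hEq.mono hIm)⟩ ⟨hJ, hEq⟩).1.antisymm hJ

theorem exists_norm_le_of_mem_reg {𝒩 : Set (Set (State n))} {t₀ : ℝ}
    {g : State n → ℝ → State n} (hg : LocallyBoundedMod 𝒩 t₀ g) (A : Set (State n))
    (hA : Bornology.IsBounded A) :
    ∃ M : ℝ, 0 < M ∧ ∀ t, t₀ ≤ t → ∀ x ∈ A, ∀ q ∈ reg 𝒩 g x t, ‖q‖ ≤ M := by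
  obtain ⟨M, hM, h⟩ := exists_ballHull_subset_closedBall hg A hA 1
  refine ⟨M, hM, fun t ht x hx q hq => ?_⟩
  obtain ⟨N, hN, h⟩ := h t ht
  simpa using h x hx (reg_subset_ballHull one_pos hN x t hq)

theorem lipschitzOnWith_glue {y z : ℝ → State n} {L L' : NNReal} {a T b : ℝ}
    (hy : LipschitzWith L y) (hz : LipschitzOnWith L' z (Icc T b)) (hyz : z T = y T) :
    LipschitzOnWith (L + L') (fun t => if t ≤ T then y t else z t) (Icc a b) := by
  have key : ∀ s ∈ Icc a b, ∀ t ∈ Icc a b, s ≤ t →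
      dist (if s ≤ T then y s else z s) (if t ≤ T then y t else z t) ≤
        (L + L' : NNReal) * (t - s) := by
    intro s hs t ht hst
    have hL : (0 : ℝ) ≤ L := L.2
    have hL' : (0 : ℝ) ≤ L' := L'.2
    push_cast
    by_cases h1 : t ≤ T
    · rw [if_pos h1, if_pos (hst.trans h1)]
      have := hy.dist_le_mul s t
      rw [Real.dist_eq, abs_sub_comm, abs_of_nonneg (by linarith)] at this
      nlinarith
    · push Not at h1
      rw [if_neg (not_le.2 h1)]
      by_cases h2 : s ≤ T
      · rw [if_pos h2]
        have h3 := hy.dist_le_mul s T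
        have h4 := hz.dist_le_mul T ⟨le_rfl, h1.le.trans ht.2⟩ t ⟨h1.le, ht.2⟩
        rw [Real.dist_eq, abs_sub_comm, abs_of_nonneg (by linarith)] at h3 h4
        rw [hyz] at h4
        have := dist_triangle (y s) (y T) (z t)
        nlinarith
      · rw [if_neg h2]
        push Not at h2
        have h4 := hz.dist_le_mul s ⟨h2.le, hs.2⟩ t ⟨h1.le, ht.2⟩
        rw [Real.dist_eq, abs_sub_comm, abs_of_nonneg (by linarith)] at h4
        nlinarith
  refine LipschitzOnWith.of_dist_le_mul fun s hs t ht => ?_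
  rcases le_total s t with h | h
  · rw [Real.dist_eq s t, abs_sub_comm, abs_of_nonneg (by linarith)]
    exact key s hs t ht h
  · rw [dist_comm, Real.dist_eq s t, abs_of_nonneg (by linarith)]
    exact key t ht s hs h

/-- A bounded maximal solution is complete: it would otherwise converge at its final time, and a
local solution could be attached there. -/
theorem IsMaximalSolution.eq_Ici {𝒩 : Set (Set (State n))} {t₀ : ℝ} {g : State n → ℝ → State n}
    (hg : LocallyBoundedMod 𝒩 t₀ g) (hs : HasSampling 𝒩 t₀ g) {x : ℝ → State n} {I : Set ℝ}
    (hx : IsMaximalSolution (reg 𝒩 g) t₀ x I) {A : Set (State n)} (hA : Bornology.IsBounded A)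
    (hxA : ∀ t ∈ I, x t ∈ A) : I = Ici t₀ := by
  have hsol := hx.1
  by_contra hne
  have hbdd : BddAbove I := by
    by_contra hb
    refine hne (Subset.antisymm (fun t ht => hsol.isLeast.2 ht) fun t ht => ?_)
    rw [not_bddAbove_iff] at hb
    obtain ⟨s, hs, hts⟩ := hb t
    exact hsol.ordConnected.out hsol.isLeast.1 hs ⟨ht, hts.le⟩
  set T := sSup I with hT
  have hIT : ∀ t ∈ I, t ≤ T := fun t ht => le_csSup hbdd ht
  have ht₀T : t₀ < T := by
    obtain ⟨b, hb, hbne⟩ := hsol.nontrivial.exists_ne t₀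
    exact (lt_of_le_of_ne (hsol.isLeast.2 hb) hbne.symm).trans_le (hIT b hb)
  obtain ⟨M, hM, hMb⟩ := exists_norm_le_of_mem_reg hg A hA
  have hlip : LipschitzOnWith M.toNNReal x I := LipschitzOnWith.of_dist_le_mul fun s hs t ht => by
    rw [Real.coe_toNNReal _ hM.le, Real.dist_eq]
    exact hsol.dist_le hM.le (fun τ hτ => hMb τ (hsol.isLeast.2 hτ) _ (hxA τ hτ)) hs ht
  obtain ⟨y, hy, hxy⟩ := hlip.extend_finite_dimension
  obtain ⟨h, hh, z, hzT, ⟨L', hL'⟩, hz⟩ := exists_local_trajectory hg hs ht₀T.le (y T)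
  set ξ : ℝ → State n := fun t => if t ≤ T then y t else z t with hξ
  have hξx : EqOn x ξ I := fun t ht => by
    simp only [hξ]
    rw [if_pos (hIT t ht), hxy ht]
  have hIJ : I ⊆ Icc t₀ (T + h) := fun t ht => ⟨hsol.isLeast.2 ht, by linarith [hIT t ht]⟩
  have hξsol : IsSolution (reg 𝒩 g) t₀ ξ (Icc t₀ (T + h)) := by
    refine ⟨ordConnected_Icc, hsol.nontrivial.mono hIJ, isLeast_Icc (by linarith), ?_, ?_⟩
    · intro a ha b hb
      exact ((lipschitzOnWith_glue hy hL' hzT).mono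
        (ordConnected_Icc.uIcc_subset ha hb)).absolutelyContinuousOnInterval
    · have hne1 : ∀ᵐ t : ℝ, t ≠ T := by simp [ae_iff, measure_singleton]
      have hne2 : ∀ᵐ t : ℝ, t ≠ T + h := by simp [ae_iff, measure_singleton]
      filter_upwards [hsol.ae_hasDerivAt, hz, hne1, hne2,
        ae_mem_nhds_of_ordConnected hsol.ordConnected] with t h1 h2 h3 h4 h5 ht
      rcases lt_or_gt_of_ne h3 with hlt | hgt
      · obtain ⟨b, hb, htb⟩ := exists_lt_of_lt_csSup hsol.nontrivial.nonempty hlt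
        have htI : t ∈ I := hsol.ordConnected.out hsol.isLeast.1 hb ⟨ht.1, htb.le⟩
        obtain ⟨q, hq, hd⟩ := h1 htI
        have heq : ξ =ᶠ[𝓝 t] x := by
          filter_upwards [h5 htI] with τ hτ using (hξx hτ).symm
        refine ⟨q, ?_, (hd.congr_of_eventuallyEq heq).hasDerivWithinAt⟩
        rwa [← hξx htI]
      · obtain ⟨q, hq, hd⟩ := h2 ⟨hgt, lt_of_le_of_ne ht.2 h4⟩
        have heq : ξ =ᶠ[𝓝 t] z := by
          filter_upwards [Ioi_mem_nhds hgt] with τ hτ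
          exact if_neg (not_le.2 hτ)
        refine ⟨q, ?_, (hd.congr_of_eventuallyEq heq).hasDerivWithinAt⟩
        rwa [heq.eq_of_nhds]
  have hJI := hx.2 ξ _ hξsol hIJ hξx
  have : T + h ∈ I := hJI ▸ (⟨by linarith, le_rfl⟩ : T + h ∈ Icc t₀ (T + h))
  linarith [hIT _ this]

/-! ### The Clarke gradient -/

/-- The difference quotients whose upper limit is Clarke's directional derivative. -/
noncomputable def clarkeQuotient (V : State n → ℝ → ℝ) (v : State n × ℝ)
    (q : (State n × ℝ) × ℝ) : ℝ :=
  (V (q.1 + q.2 • v).1 (q.1 + q.2 • v).2 - V q.1.1 q.1.2) / q.2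

theorem clarkeDeriv_le {V : State n → ℝ → ℝ} {z v : State n × ℝ} {b : ℝ}
    (h : ∀ᶠ q in 𝓝 z ×ˢ 𝓝[>] (0 : ℝ), clarkeQuotient V v q ≤ b) :
    clarkeDeriv V z v ≤ (b : EReal) :=
  limsup_le_of_le (h := h.mono fun _ hq => EReal.coe_le_coe_iff.2 hq)

theorem eventually_clarkeQuotient_lt {V : State n → ℝ → ℝ} {z v : State n × ℝ} {b : ℝ}
    (h : clarkeDeriv V z v < (b : EReal)) :
    ∀ᶠ q in 𝓝 z ×ˢ 𝓝[>] (0 : ℝ), clarkeQuotient V v q < b :=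
  (eventually_lt_of_limsup_lt h).mono fun _ hq => EReal.coe_lt_coe_iff.1 hq

theorem tendsto_add_smul_nhds (z v : State n × ℝ) :
    Tendsto (fun q : (State n × ℝ) × ℝ => q.1 + q.2 • v) (𝓝 z ×ˢ 𝓝[>] (0 : ℝ)) (𝓝 z) := by
  have h : Continuous fun q : (State n × ℝ) × ℝ => q.1 + q.2 • v := by fun_prop
  have h1 := h.tendsto (z, 0)
  simp only [zero_smul, add_zero, nhds_prod_eq] at h1
  exact h1.mono_left (prod_mono le_rfl nhdsWithin_le_nhds)

theorem eventually_snd_pos (z : State n × ℝ) :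
    ∀ᶠ q in 𝓝 z ×ˢ 𝓝[>] (0 : ℝ), (0 : ℝ) < q.2 :=
  tendsto_snd.eventually self_mem_nhdsWithin

/-- For `V` Lipschitz near `z`, Clarke's directional derivative is real valued. -/
theorem exists_coe_eq_clarkeDeriv {V : State n → ℝ → ℝ} {z : State n × ℝ} {L : NNReal}
    {U : Set (State n × ℝ)} (hU : U ∈ 𝓝 z)
    (hV : LipschitzOnWith L (fun p : State n × ℝ => V p.1 p.2) U) (v : State n × ℝ) :
    ∃ d : ℝ, (d : EReal) = clarkeDeriv V z v ∧ |d| ≤ L * ‖v‖ := by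
  have hev : ∀ᶠ q in 𝓝 z ×ˢ 𝓝[>] (0 : ℝ), |clarkeQuotient V v q| ≤ L * ‖v‖ := by
    filter_upwards [tendsto_fst.eventually hU, (tendsto_add_smul_nhds z v).eventually hU,
      eventually_snd_pos z] with q h1 h2 h3
    have h4 := hV.dist_le_mul _ h2 _ h1
    rw [Real.dist_eq, dist_eq_norm, add_sub_cancel_left, norm_smul, Real.norm_eq_abs,
      abs_of_pos h3] at h4
    rw [clarkeQuotient, abs_div, abs_of_pos h3, div_le_iff₀ h3]
    linarith
  have hle : clarkeDeriv V z v ≤ ((L * ‖v‖ : ℝ) : EReal) :=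
    clarkeDeriv_le (hev.mono fun q hq => (abs_le.1 hq).2)
  have hge : ((-(L * ‖v‖) : ℝ) : EReal) ≤ clarkeDeriv V z v :=
    le_limsup_of_frequently_le (hev.mono fun q hq =>
      EReal.coe_le_coe_iff.2 (abs_le.1 hq).1).frequently
  have htop : clarkeDeriv V z v ≠ ⊤ := (hle.trans_lt (EReal.coe_lt_top _)).ne
  have hbot : clarkeDeriv V z v ≠ ⊥ := ((EReal.bot_lt_coe _).trans_le hge).ne'
  have hco := EReal.coe_toReal htop hbot
  refine ⟨_, hco, ?_⟩
  rw [← hco, EReal.coe_le_coe_iff] at hle hge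
  exact abs_le.2 ⟨hge, hle⟩

/-- Clarke's directional derivative is the support function of the Clarke gradient: it is
sublinear, so the Hahn–Banach theorem yields an element of the gradient attaining it. -/
theorem exists_mem_clarkeGradient {V : State n → ℝ → ℝ} {x : State n} {t : ℝ} {L : NNReal}
    {U : Set (State n × ℝ)} (hU : U ∈ 𝓝 (x, t))
    (hV : LipschitzOnWith L (fun p : State n × ℝ => V p.1 p.2) U) {v : State n × ℝ} (hv : v ≠ 0) :
    ∃ p ∈ clarkeGradient V x t,
      ((inner ℝ p.1 v.1 + p.2 * v.2 : ℝ) : EReal) = clarkeDeriv V (x, t) v := by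
  choose d hd hdL using exists_coe_eq_clarkeDeriv hU hV
  have hlt : ∀ {w : State n × ℝ} {b : ℝ}, d w < b → ∀ᶠ q in 𝓝 (x, t) ×ˢ 𝓝[>] (0 : ℝ),
      clarkeQuotient V w q < b := fun {w b} h =>
    eventually_clarkeQuotient_lt (by rw [← hd, EReal.coe_lt_coe_iff]; exact h)
  have hle : ∀ {w : State n × ℝ} {b : ℝ}, (∀ᶠ q in 𝓝 (x, t) ×ˢ 𝓝[>] (0 : ℝ),
      clarkeQuotient V w q ≤ b) → d w ≤ b := fun {w b} h => by
    rw [← EReal.coe_le_coe_iff, hd]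
    exact clarkeDeriv_le h
  have hd0 : d 0 = 0 := by simpa using hdL 0
  have hsmul_le : ∀ c : ℝ, 0 < c → ∀ w, d (c • w) ≤ c * d w := by
    intro c hc w
    have hmap : Tendsto (fun q : (State n × ℝ) × ℝ => (q.1, q.2 * c))
        (𝓝 (x, t) ×ˢ 𝓝[>] (0 : ℝ)) (𝓝 (x, t) ×ˢ 𝓝[>] (0 : ℝ)) := by
      refine tendsto_fst.prodMk (Tendsto.comp (g := fun s : ℝ => s * c) ?_ tendsto_snd)
      refine tendsto_nhdsWithin_of_tendsto_nhds_of_eventually_within _ ?_ ?_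
      · have h : Continuous fun s : ℝ => s * c := by fun_prop
        have := h.tendsto 0
        simp only [zero_mul] at this
        exact this.mono_left nhdsWithin_le_nhds
      · filter_upwards [self_mem_nhdsWithin] with s hs using mul_pos hs hc
    refine le_of_forall_pos_le_add fun ε hε => ?_
    refine hle ?_
    filter_upwards [hmap.eventually (hlt (lt_add_of_pos_right (d w) (div_pos hε hc))),
      eventually_snd_pos (x, t)] with q h1 h2
    have h3 : clarkeQuotient V (c • w) q = c * clarkeQuotient V w (q.1, q.2 * c) := by
      simp only [clarkeQuotient, smul_smul]
      field_simp
    rw [h3]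
    calc c * clarkeQuotient V w (q.1, q.2 * c) ≤ c * (d w + ε / c) :=
          mul_le_mul_of_nonneg_left h1.le hc.le
      _ = c * d w + ε := by field_simp
  have hsmul : ∀ c : ℝ, 0 < c → ∀ w, d (c • w) = c * d w := by
    intro c hc w
    refine le_antisymm (hsmul_le c hc w) ?_
    have h := hsmul_le c⁻¹ (inv_pos.2 hc) (c • w)
    rw [inv_smul_smul₀ hc.ne', inv_mul_eq_div, le_div_iff₀ hc] at h
    linarith
  have hadd : ∀ w w', d (w + w') ≤ d w + d w' := by
    intro w w'
    refine le_of_forall_pos_le_add fun ε hε => ?_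
    refine hle ?_
    have hmap : Tendsto (fun q : (State n × ℝ) × ℝ => (q.1 + q.2 • w, q.2))
        (𝓝 (x, t) ×ˢ 𝓝[>] (0 : ℝ)) (𝓝 (x, t) ×ˢ 𝓝[>] (0 : ℝ)) :=
      (tendsto_add_smul_nhds _ _).prodMk tendsto_snd
    filter_upwards [hlt (lt_add_of_pos_right (d w) (half_pos hε)),
      hmap.eventually (hlt (lt_add_of_pos_right (d w') (half_pos hε)))] with q h1 h2
    have h3 : clarkeQuotient V (w + w') q =
        clarkeQuotient V w q + clarkeQuotient V w' (q.1 + q.2 • w, q.2) := by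
      simp only [clarkeQuotient, smul_add, ← add_assoc]
      ring
    rw [h3]
    linarith
  obtain ⟨G, hG1, hG2⟩ := exists_extension_of_le_sublinear
    (LinearPMap.mkSpanSingleton v (d v) hv) d hsmul hadd (by
      rintro ⟨w, hw⟩
      obtain ⟨c, rfl⟩ := Submodule.mem_span_singleton.1 hw
      have hval : LinearPMap.mkSpanSingleton v (d v) hv ⟨c • v, hw⟩ = c * d v :=
        LinearPMap.mkSpanSingleton'_apply v (d v) _ c hw
      rw [hval]
      rcases lt_trichotomy c 0 with hc | hc | hc
      · have h1 := hsmul (-c) (neg_pos.2 hc) v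
        have h2 := hadd (c • v) (-c • v)
        rw [← add_smul, add_neg_cancel, zero_smul, hd0] at h2
        simp only
        linarith
      · simp [hc, hd0]
      · exact (hsmul c hc v).ge)
  have hGv : G v = d v := by
    have := hG1 ⟨v, Submodule.mem_span_singleton_self v⟩
    rw [this]
    exact LinearPMap.mkSpanSingleton_apply ℝ ℝ hv (d v)
  set p₁ : State n := (InnerProductSpace.toDual ℝ (State n)).symm
    (LinearMap.toContinuousLinearMap (G.comp (LinearMap.inl ℝ (State n) ℝ))) with hp₁
  have hrep : ∀ w : State n × ℝ, inner ℝ p₁ w.1 + G (0, 1) * w.2 = G w := by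
    intro w
    have h1 : inner ℝ p₁ w.1 = G (w.1, 0) := by
      rw [hp₁, InnerProductSpace.toDual_symm_apply]
      simp
    have h2 : w = (w.1, 0) + w.2 • ((0, 1) : State n × ℝ) := by
      ext <;> simp
    conv_rhs => rw [h2, map_add, map_smul, smul_eq_mul]
    rw [h1, mul_comm]
  refine ⟨(p₁, G (0, 1)), fun w => ?_, ?_⟩
  · rw [hrep, ← hd, EReal.coe_le_coe_iff]
    exact hG2 w
  · rw [hrep, hGv, hd]

/-- The derivative of `V` along a curve is bounded by every upper bound of `pᵀ[q;1]` over the Clarke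
gradient, where `q` is the velocity of the curve. -/
theorem deriv_le_of_clarkeGradient {V : State n → ℝ → ℝ} {x : ℝ → State n} {t : ℝ} {L : NNReal}
    {U : Set (State n × ℝ)} (hU : U ∈ 𝓝 (x t, t))
    (hV : LipschitzOnWith L (fun p : State n × ℝ => V p.1 p.2) U) {q : State n}
    (hx : HasDerivAt x q t) {v' : ℝ} (hv : HasDerivAt (fun τ => V (x τ) τ) v' t) {β : ℝ}
    (hβ : ∀ p ∈ clarkeGradient V (x t) t, inner ℝ p.1 q + p.2 * 1 ≤ β) : v' ≤ β := by
  obtain ⟨p, hp, hpe⟩ := exists_mem_clarkeGradient hU hV (v := (q, 1))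
    (fun h => one_ne_zero (congrArg Prod.snd h))
  refine le_trans ?_ (hβ p hp)
  refine le_of_forall_pos_le_add fun ε hε => ?_
  have hlt : clarkeDeriv V (x t, t) (q, 1) < ((inner ℝ p.1 q + p.2 * 1 + ε : ℝ) : EReal) := by
    rw [← hpe, EReal.coe_lt_coe_iff]
    exact lt_add_of_pos_right _ hε
  have hpure : Tendsto (fun s : ℝ => ((x t, t), s)) (𝓝[>] (0 : ℝ))
      (𝓝 (x t, t) ×ˢ 𝓝[>] (0 : ℝ)) := tendsto_const_nhds.prodMk tendsto_id
  have hev := hpure.eventually (eventually_clarkeQuotient_lt hlt)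
  -- Replacing the curve by its tangent line changes the difference quotient by `o(1)`.
  have h1 : Tendsto (fun s : ℝ => s⁻¹ • (V (x (t + s)) (t + s) - V (x t) t)) (𝓝[>] 0) (𝓝 v') :=
    hv.tendsto_slope_zero_right
  have h2 : Tendsto (fun s : ℝ => (L : ℝ) * ‖s⁻¹ • (x (t + s) - x t) - q‖) (𝓝[>] 0) (𝓝 0) := by
    have h3 := hx.tendsto_slope_zero_right
    have h4 := (h3.sub_const q).norm.const_mul (L : ℝ)
    simpa using h4
  have hcurve : ∀ᶠ s in 𝓝[>] (0 : ℝ), (x (t + s), t + s) ∈ U := by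
    have hc : ContinuousAt (fun s : ℝ => (x (t + s), t + s)) 0 := by
      refine ContinuousAt.prodMk ?_ (by fun_prop)
      refine ContinuousAt.comp (g := x) ?_ (by fun_prop)
      simpa using hx.continuousAt
    have := hc.tendsto
    simp only [add_zero] at this
    exact (this.mono_left nhdsWithin_le_nhds).eventually hU
  have hline : ∀ᶠ s in 𝓝[>] (0 : ℝ), ((x t, t) + s • (q, (1 : ℝ))) ∈ U :=
    ((tendsto_add_smul_nhds (x t, t) (q, 1)).comp hpure).eventually hU
  refine le_of_tendsto (by simpa using h1.sub h2) ?_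
  filter_upwards [hev, hcurve, hline, self_mem_nhdsWithin] with s h3 h4 h5 (h6 : 0 < s)
  have h7 := hV.dist_le_mul _ h4 _ h5
  have h8 : dist (x (t + s), t + s) ((x t, t) + s • (q, (1 : ℝ))) =
      s * ‖s⁻¹ • (x (t + s) - x t) - q‖ := by
    have h9 : x (t + s) - (x t + s • q) = s • (s⁻¹ • (x (t + s) - x t) - q) := by
      rw [smul_sub, smul_inv_smul₀ h6.ne']; abel
    rw [dist_eq_norm]
    simp only [Prod.smul_mk, Prod.mk_add_mk, Prod.mk_sub_mk, smul_eq_mul, mul_one, sub_self]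
    rw [h9, Prod.norm_mk, norm_zero, max_eq_left (norm_nonneg _), norm_smul, Real.norm_eq_abs,
      abs_of_pos h6]
  rw [h8, Real.dist_eq] at h7
  simp only [clarkeQuotient] at h3
  rw [div_lt_iff₀ h6] at h3
  have h10 := (abs_le.1 h7).2
  rw [inv_mul_eq_div, sub_le_iff_le_add, div_le_iff₀ h6]
  linarith

theorem le_of_generalizedTimeDeriv_le {F : State n → ℝ → Set (State n)} {V : State n → ℝ → ℝ}
    {x : State n} {t b : ℝ} (h : generalizedTimeDeriv F V x t ≤ (b : EReal)) {p : State n × ℝ}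
    (hp : p ∈ clarkeGradient V x t) {q : State n} (hq : q ∈ F x t) :
    inner ℝ p.1 q + p.2 * 1 ≤ b := by
  rw [← EReal.coe_le_coe_iff]
  refine le_trans ?_ h
  exact le_iSup₂_of_le p hp (le_iSup₂_of_le q hq le_rfl)

/-! ### Decrease of the Lyapunov function and Barbalat's lemma -/

/-- Barbalat's lemma: a nonnegative uniformly continuous function with bounded integrals tends to
zero. -/
theorem tendsto_zero_of_integral_le {φ : ℝ → ℝ} {t₀ C : ℝ} (hφ : ∀ t, t₀ ≤ t → 0 ≤ φ t)
    (huc : UniformContinuousOn φ (Ici t₀)) (hC : ∀ T, t₀ ≤ T → ∫ τ in t₀..T, φ τ ≤ C) :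
    Tendsto φ atTop (𝓝 0) := by
  have hint : ∀ a b, t₀ ≤ a → t₀ ≤ b → IntervalIntegrable φ volume a b := fun a b ha hb =>
    (huc.continuousOn.mono fun t ht => (le_min ha hb).trans ht.1).intervalIntegrable
  have hmono : ∀ a b, t₀ ≤ a → a ≤ b → ∫ τ in t₀..a, φ τ ≤ ∫ τ in t₀..b, φ τ := by
    intro a b ha hab
    rw [← intervalIntegral.integral_add_adjacent_intervals (hint t₀ a le_rfl ha)
      (hint a b ha (ha.trans hab))]
    have : 0 ≤ ∫ τ in a..b, φ τ :=
      intervalIntegral.integral_nonneg hab fun τ hτ => hφ τ (ha.trans hτ.1)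
    linarith
  set G : ℝ → ℝ := fun t => ∫ τ in t₀..(max t t₀), φ τ with hG
  have hGm : Monotone G := fun a b hab =>
    hmono _ _ (le_max_right _ _) (max_le_max hab le_rfl)
  have hGlim := tendsto_atTop_ciSup hGm ⟨C, by
    rintro _ ⟨t, rfl⟩
    exact hC _ (le_max_right _ _)⟩
  refine Metric.tendsto_atTop.2 fun ε hε => ?_
  obtain ⟨δ, hδ, hδφ⟩ := Metric.uniformContinuousOn_iff.1 huc (ε / 2) (by positivity)
  have hsh : Tendsto (fun t => G (t + δ / 2) - G t) atTop (𝓝 0) := by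
    simpa using (hGlim.comp (tendsto_atTop_add_const_right _ (δ / 2) tendsto_id)).sub hGlim
  have hev := hsh.eventually_lt_const (by positivity : (0 : ℝ) < ε / 2 * (δ / 2))
  obtain ⟨T, hT⟩ := eventually_atTop.1 (hev.and (eventually_ge_atTop t₀))
  refine ⟨T, fun t ht => ?_⟩
  obtain ⟨h1, h2⟩ := hT t ht
  rw [Real.dist_0_eq_abs, abs_of_nonneg (hφ t h2)]
  by_contra! hge
  have h3 : G (t + δ / 2) - G t = ∫ τ in t..(t + δ / 2), φ τ := by
    simp only [hG]
    rw [max_eq_left h2, max_eq_left (by linarith), intervalIntegral.integral_interval_sub_left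
      (hint _ _ le_rfl (by linarith)) (hint _ _ le_rfl h2)]
  have h4 : ∫ _τ in t..(t + δ / 2), ε / 2 ≤ ∫ τ in t..(t + δ / 2), φ τ := by
    refine intervalIntegral.integral_mono_on (by linarith) intervalIntegrable_const
      (hint _ _ h2 (by linarith)) fun τ hτ => ?_
    have h5 := hδφ τ (h2.trans hτ.1) t h2 (by
      rw [Real.dist_eq, abs_of_nonneg (by linarith [hτ.1])]
      linarith [hτ.2])
    rw [Real.dist_eq] at h5
    linarith [(abs_lt.1 h5).1]
  rw [intervalIntegral.integral_const, smul_eq_mul] at h4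
  rw [h3] at h1
  linarith

/-- Along a solution in `D` with bounded velocities, `V` decreases at least by the integral of the
decay rate `W`. -/
theorem energy_le {F : State n → ℝ → Set (State n)} {t₀ T : ℝ} {D : Set (State n)}
    (hD : IsOpen D) {V : State n → ℝ → ℝ} {W : State n → ℝ}
    (hV : LocallyLipschitzOn (D ×ˢ Ici t₀) (fun p : State n × ℝ => V p.1 p.2))
    (hW : ContinuousOn W D)
    (hdec : ∀ᵐ t : ℝ, t₀ ≤ t → ∀ x ∈ D, generalizedTimeDeriv F V x t ≤ ((-W x : ℝ) : EReal))
    {x : ℝ → State n} (hx : IsSolution F t₀ x (Icc t₀ T)) (hxD : ∀ t ∈ Icc t₀ T, x t ∈ D)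
    {M : ℝ} (hM0 : 0 ≤ M) (hM : ∀ t ∈ Icc t₀ T, ∀ q ∈ F (x t) t, ‖q‖ ≤ M) :
    V (x T) T + ∫ τ in t₀..T, W (x τ) ≤ V (x t₀) t₀ := by
  have hT : t₀ ≤ T := nonempty_Icc.1 hx.nontrivial.nonempty
  have hTmem : T ∈ Icc t₀ T := right_mem_Icc.2 hT
  have hcont : ContinuousOn x (Icc t₀ T) := hx.continuousOn hTmem
  have hΓ : IsCompact ((fun τ => (x τ, τ)) '' Icc t₀ T) :=
    isCompact_Icc.image_of_continuousOn (hcont.prodMk continuousOn_id)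
  have hΓD : (fun τ => (x τ, τ)) '' Icc t₀ T ⊆ D ×ˢ Ici t₀ := by
    rintro _ ⟨τ, hτ, rfl⟩
    exact ⟨hxD τ hτ, hτ.1⟩
  obtain ⟨L, hL⟩ := (hV.mono hΓD).exists_lipschitzOnWith_of_compact hΓ
  have hac : AbsolutelyContinuousOnInterval (fun τ => V (x τ) τ) t₀ T := by
    refine absolutelyContinuousOnInterval_of_dist_le (g := id) (C := L * (M + 1))
      (LipschitzWith.id.lipschitzOnWith.absolutelyContinuousOnInterval) fun s hs t ht => ?_
    rw [uIcc_of_le hT] at hs ht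
    have h1 := hL.dist_le_mul _ ⟨s, hs, rfl⟩ _ ⟨t, ht, rfl⟩
    have h2 := hx.dist_le hM0 hM hs ht
    have h3 : dist (x s, s) (x t, t) ≤ (M + 1) * |s - t| := by
      rw [Prod.dist_eq, Real.dist_eq]
      refine max_le ?_ ?_ <;> nlinarith [abs_nonneg (s - t)]
    simp only [id, Real.dist_eq s t, mul_assoc]
    exact h1.trans (mul_le_mul_of_nonneg_left h3 L.2)
  have hWint : IntervalIntegrable (fun τ => W (x τ)) volume t₀ T := by
    refine ContinuousOn.intervalIntegrable ?_
    rw [uIcc_of_le hT]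
    exact hW.comp hcont hxD
  have hint : ∫ τ in t₀..T, deriv (fun τ => V (x τ) τ) τ ≤ ∫ τ in t₀..T, -W (x τ) := by
    refine intervalIntegral.integral_mono_ae_restrict hT hac.intervalIntegrable_deriv hWint.neg ?_
    rw [EventuallyLE, ae_restrict_iff' measurableSet_Icc]
    have hne : ∀ᵐ t : ℝ, t ≠ t₀ := by simp [ae_iff, measure_singleton]
    filter_upwards [hac.ae_differentiableAt, hx.ae_hasDerivAt, hdec, hne] with t h1 h2 h3 h4 ht
    rw [uIcc_of_le hT] at h1
    obtain ⟨q, hq, hd⟩ := h2 ht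
    obtain ⟨K, U, hU, hUL⟩ := hV (x := (x t, t)) ⟨hxD t ht, ht.1⟩
    have hnhds : D ×ˢ Ici t₀ ∈ 𝓝 (x t, t) :=
      prod_mem_nhds (hD.mem_nhds (hxD t ht)) (Ici_mem_nhds (lt_of_le_of_ne ht.1 h4.symm))
    rw [nhdsWithin_eq_nhds.2 hnhds] at hU
    refine deriv_le_of_clarkeGradient hU hUL hd (h1 ht).hasDerivAt fun p hp => ?_
    exact le_of_generalizedTimeDeriv_le (h3 ht.1 _ (hxD t ht)) hp hq
  rw [hac.integral_deriv_eq_sub, intervalIntegral.integral_neg] at hint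
  linarith

/-! ### Stability of the switched system -/

/-- If every solution starting in `S` stays in some compact subset of `D`, then the solutions
starting in `S` are complete, bounded and satisfy `W(x(t)) → 0`. -/
theorem solutionsCompleteBoundedConverge_of_mem_compact {𝒩 : Set (Set (State n))} {t₀ : ℝ}
    {g : State n → ℝ → State n} (hg : LocallyBoundedMod 𝒩 t₀ g) (hs : HasSampling 𝒩 t₀ g)
    {D : Set (State n)} (hD : IsOpen D) {V : State n → ℝ → ℝ} {Wl Wu W : State n → ℝ}
    {F' : State n → ℝ → Set (State n)} (hV : IsNonStrictLyapunov F' t₀ D V Wl Wu W)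
    (hdec : ∀ᵐ t : ℝ, t₀ ≤ t → ∀ x ∈ D,
      generalizedTimeDeriv (reg 𝒩 g) V x t ≤ ((-W x : ℝ) : EReal)) {S : Set (State n)}
    (hS : ∀ (x : ℝ → State n) (I : Set ℝ), IsSolution (reg 𝒩 g) t₀ x I → x t₀ ∈ S →
      ∃ A : Set (State n), IsCompact A ∧ A ⊆ D ∧ ∀ t ∈ I, x t ∈ A) :
    SolutionsCompleteBoundedConverge (reg 𝒩 g) t₀ W S := by
  refine ⟨fun x I hx _ => hx.exists_maximal, fun x I hx hxS => ?_⟩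
  obtain ⟨A, hA, hAD, hxA⟩ := hS x I hx.1 hxS
  obtain rfl : I = Ici t₀ := hx.eq_Ici hg hs hA.isBounded hxA
  refine ⟨rfl, hA.isBounded.subset (image_subset_iff.2 hxA), ?_⟩
  obtain ⟨M, hM, hMb⟩ := exists_norm_le_of_mem_reg hg A hA.isBounded
  have hspeed : ∀ t ∈ Ici t₀, ∀ q ∈ reg 𝒩 g (x t) t, ‖q‖ ≤ M := fun t ht =>
    hMb t ht _ (hxA t ht)
  have hlip : LipschitzOnWith M.toNNReal x (Ici t₀) :=
    LipschitzOnWith.of_dist_le_mul fun s hs t ht => by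
      rw [Real.coe_toNNReal _ hM.le, Real.dist_eq]
      exact hx.1.dist_le hM.le hspeed hs ht
  refine tendsto_zero_of_integral_le (t₀ := t₀) (C := V (x t₀) t₀)
    (fun t ht => hV.nonneg_rate _ (hAD (hxA t ht))) ?_ fun T hT => ?_
  · exact (hA.uniformContinuousOn_of_continuous (hV.continuous_rate.mono hAD)).comp
      hlip.uniformContinuousOn hxA
  · have ht₀ : t₀ ∈ Ici t₀ := self_mem_Ici
    rcases hT.eq_or_lt with rfl | hlt
    · rw [intervalIntegral.integral_same]
      exact (hV.posDef _ le_rfl _ (hAD (hxA _ ht₀))).1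
    · have hsub : Icc t₀ T ⊆ Ici t₀ := Icc_subset_Ici_self
      have h := energy_le hD hV.locallyLipschitz hV.continuous_rate hdec
        (hx.1.restrict hsub ordConnected_Icc
          ⟨t₀, left_mem_Icc.2 hT, T, right_mem_Icc.2 hT, hlt.ne⟩ (isLeast_Icc hT))
        (fun t ht => hAD (hxA t (hsub ht))) hM.le fun t ht => hspeed t (hsub ht)
      have := (hV.posDef T hT _ (hAD (hxA T hT))).1
      linarith

/-- Along a solution that stays in `D` up to time `T`, the lower bound `Wl` does not exceed the
initial value of the upper bound `Wu`. -/
theorem lower_le_upper_of_mem {𝒩 : Set (Set (State n))} {t₀ : ℝ}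
    {g : State n → ℝ → State n} (hg : LocallyBoundedMod 𝒩 t₀ g)
    {D : Set (State n)} (hD : IsOpen D) {V : State n → ℝ → ℝ} {Wl Wu W : State n → ℝ}
    {F' : State n → ℝ → Set (State n)} (hV : IsNonStrictLyapunov F' t₀ D V Wl Wu W)
    (hdec : ∀ᵐ t : ℝ, t₀ ≤ t → ∀ x ∈ D,
      generalizedTimeDeriv (reg 𝒩 g) V x t ≤ ((-W x : ℝ) : EReal)) {x : ℝ → State n} {I : Set ℝ}
    (hx : IsSolution (reg 𝒩 g) t₀ x I) {T : ℝ} (hT : T ∈ I) (hxD : ∀ t ∈ Icc t₀ T, x t ∈ D) :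
    Wl (x T) ≤ Wu (x t₀) := by
  have hT₀ := hx.isLeast.2 hT
  have hmT : T ∈ Icc t₀ T := right_mem_Icc.2 hT₀
  have hm₀ : t₀ ∈ Icc t₀ T := left_mem_Icc.2 hT₀
  refine (hV.bounds _ (hxD T hmT) T hT₀).1.trans
    (le_trans ?_ (hV.bounds _ (hxD t₀ hm₀) t₀ le_rfl).2)
  rcases hT₀.eq_or_lt with rfl | hlt
  · exact le_rfl
  · have hbdd : Bornology.IsBounded (x '' Icc t₀ T) :=
      (isCompact_Icc.image_of_continuousOn (hx.continuousOn hT)).isBounded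
    obtain ⟨M, hM, hMb⟩ := exists_norm_le_of_mem_reg hg _ hbdd
    have h := energy_le hD hV.locallyLipschitz hV.continuous_rate hdec
      (hx.restrict (hx.ordConnected.out hx.isLeast.1 hT) ordConnected_Icc ⟨t₀, hm₀, T, hmT, hlt.ne⟩
        (isLeast_Icc hT₀)) hxD hM.le fun t ht => hMb t ht.1 _ ⟨t, ht, rfl⟩
    have hnn : 0 ≤ ∫ τ in t₀..T, W (x τ) :=
      intervalIntegral.integral_nonneg hT₀ fun τ hτ => hV.nonneg_rate _ (hxD τ hτ)
    linarith

/-- A solution starting in `B(0,r) ∩ {Wu ≤ c}` cannot reach the sphere of radius `r`, where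
`Wl > c`. -/
theorem mem_closedBall_of_isSolution {𝒩 : Set (Set (State n))} {t₀ : ℝ}
    {g : State n → ℝ → State n} (hg : LocallyBoundedMod 𝒩 t₀ g)
    {D : Set (State n)} (hD : IsOpen D) {V : State n → ℝ → ℝ} {Wl Wu W : State n → ℝ}
    {F' : State n → ℝ → Set (State n)} (hV : IsNonStrictLyapunov F' t₀ D V Wl Wu W)
    (hdec : ∀ᵐ t : ℝ, t₀ ≤ t → ∀ x ∈ D,
      generalizedTimeDeriv (reg 𝒩 g) V x t ≤ ((-W x : ℝ) : EReal)) {r c : ℝ}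
    (hrD : Metric.closedBall 0 r ⊆ D) (hc : ∀ y ∈ Metric.sphere (0 : State n) r, c < Wl y)
    {x : ℝ → State n} {I : Set ℝ} (hx : IsSolution (reg 𝒩 g) t₀ x I)
    (hx₀ : x t₀ ∈ Metric.ball 0 r) (hx₀c : Wu (x t₀) ≤ c) :
    ∀ t ∈ I, x t ∈ Metric.closedBall 0 r := by
  intro T hT
  by_contra hout
  rw [mem_closedBall_zero_iff, not_le] at hout
  rw [mem_ball_zero_iff] at hx₀
  have hT₀ := hx.isLeast.2 hT
  have hcont : ContinuousOn (fun t => ‖x t‖) (Icc t₀ T) := (hx.continuousOn hT).norm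
  -- `t₁` is the first time in `[t₀,T]` at which the solution is not in the open ball.
  have hcomp : IsCompact (Icc t₀ T ∩ (fun t => ‖x t‖) ⁻¹' Ici r) :=
    isCompact_Icc.of_isClosed_subset (hcont.preimage_isClosed_of_isClosed isClosed_Icc isClosed_Ici)
      inter_subset_left
  obtain ⟨t₁, ⟨ht₁, hrt₁⟩, hleast⟩ := hcomp.exists_isLeast ⟨T, right_mem_Icc.2 hT₀, hout.le⟩
  obtain ⟨s, hs, hsr⟩ := intermediate_value_Icc ht₁.1
    (hcont.mono (Icc_subset_Icc_right ht₁.2)) ⟨hx₀.le, hrt₁⟩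
  have hst : s = t₁ := hs.2.antisymm (hleast ⟨⟨hs.1, hs.2.trans ht₁.2⟩, hsr.ge⟩)
  subst hst
  have hin : ∀ t ∈ Icc t₀ s, x t ∈ D := by
    intro t ht
    refine hrD (mem_closedBall_zero_iff.2 ?_)
    rcases ht.2.eq_or_lt with rfl | hlt
    · exact hsr.le
    · by_contra! hgt
      exact (hleast ⟨⟨ht.1, ht.2.trans ht₁.2⟩, hgt.le⟩).not_gt hlt
  have hsI : s ∈ I := hx.ordConnected.out hx.isLeast.1 hT ht₁
  have h1 := lower_le_upper_of_mem hg hD hV hdec hx hsI hin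
  have h2 := hc (x s) (mem_sphere_zero_iff_norm.2 hsr)
  linarith

/-- The local and the global convergence statement for the regularization with respect to any
negligible family for which the switched field can be sampled. -/
theorem switched_convergence {𝒩 : Set (Set (State n))} (h𝒩 : IsNegligibleFamily 𝒩) {t₀ : ℝ}
    {N₀ : Set ℕ} {f : ℕ → State n → ℝ → State n} {ρ : State n → ℝ → ℕ}
    (hf : ∀ K : Set (State n), IsCompact K → ∃ M : ℝ, 0 < M ∧ ∀ σ ∈ N₀, ∀ t, t₀ ≤ t →
      ∃ N ∈ 𝒩, ∀ x ∈ K \ N, ‖f σ x t‖ ≤ M) (hρN : ∀ x t, t₀ ≤ t → ρ x t ∈ N₀)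
    (hρ : LocallyFiniteSwitching t₀ ρ) (hs : HasSampling 𝒩 t₀ (switchedField f ρ))
    {D : Set (State n)} (hD : IsOpen D) {V : State n → ℝ → ℝ} {Wl Wu W : State n → ℝ}
    (hV : IsCommonNonStrictLyapunov N₀ (fun σ => reg 𝒩 (f σ)) t₀ D V Wl Wu W) :
    (∀ r : ℝ, 0 < r → Metric.closedBall 0 r ⊆ D →
      ∀ c : ℝ, 0 < c → (∀ y ∈ Metric.sphere (0 : State n) r, c < Wl y) →
        SolutionsCompleteBoundedConverge (reg 𝒩 (switchedField f ρ)) t₀ W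
          {x | x ∈ Metric.ball 0 r ∧ Wu x ≤ c}) ∧
    (D = univ → (∀ c : ℝ, 0 < c → IsCompact {x | Wl x ≤ c}) →
      SolutionsCompleteBoundedConverge (reg 𝒩 (switchedField f ρ)) t₀ W univ) := by
  have hfσ : ∀ σ ∈ N₀, LocallyBoundedMod 𝒩 t₀ (f σ) := fun σ hσ K hK => by
    obtain ⟨M, hM, h⟩ := hf K hK
    exact ⟨M, hM, h σ hσ⟩
  have hg := locallyBoundedMod_switchedField h𝒩 hf hρN
  have hV₀ := hV _ (hρN 0 t₀ le_rfl)
  have hdec : ∀ᵐ t : ℝ, t₀ ≤ t → ∀ x ∈ D,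
      generalizedTimeDeriv (reg 𝒩 (switchedField f ρ)) V x t ≤ ((-W x : ℝ) : EReal) := by
    have hall : ∀ᵐ t : ℝ, ∀ σ ∈ N₀, t₀ ≤ t → ∀ x ∈ D,
        generalizedTimeDeriv (reg 𝒩 (f σ)) V x t ≤ ((-W x : ℝ) : EReal) :=
      (ae_ball_iff N₀.to_countable).2 fun σ hσ => (hV σ hσ).decrease
    filter_upwards [hall] with t h ht x hx
    refine iSup₂_le fun p hp => iSup₂_le fun q hq => ?_
    rw [EReal.coe_le_coe_iff]
    have hmode : ∀ σ ∈ N₀, ∀ q ∈ reg 𝒩 (f σ) x t, inner ℝ p.1 q ≤ -W x - p.2 := by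
      intro σ hσ q hq
      linarith [le_of_generalizedTimeDeriv_le (h σ hσ ht x hx) hp hq]
    linarith [inner_le_of_mem_reg_switchedField h𝒩 hfσ hρN hρ ht p.1 hmode hq]
  refine ⟨fun r _ hrD c _ hc => ?_, fun hDu hcomp => ?_⟩
  · exact solutionsCompleteBoundedConverge_of_mem_compact hg hs hD hV₀ hdec
      fun x I hx hx₀ => ⟨Metric.closedBall 0 r, isCompact_closedBall _ _, hrD,
        mem_closedBall_of_isSolution hg hD hV₀ hdec hrD hc hx hx₀.1 hx₀.2⟩
  · refine solutionsCompleteBoundedConverge_of_mem_compact hg hs hD hV₀ hdec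
      fun x I hx _ => ⟨{y | Wl y ≤ Wu (x t₀) + 1}, hcomp _ ?_, hDu ▸ subset_univ _, fun t ht => ?_⟩
    · -- One is added because `Wu (x t₀)` vanishes when the solution starts at the origin.
      linarith [(hV₀.posDef_upper (x t₀) (hDu ▸ mem_univ _)).1]
    · have := lower_le_upper_of_mem hg hD hV₀ hdec hx ht fun t _ => hDu ▸ mem_univ _
      rw [mem_ofPred_eq]
      linarith

end SwitchedSystem

open SwitchedSystem in
theorem theorem2 {n : ℕ} (t₀ : ℝ) (N₀ : Set ℕ) (f : ℕ → State n → ℝ → State n)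
    (ρ : State n → ℝ → ℕ) (hρ : LocallyFiniteSwitching t₀ ρ)
    (D : Set (State n)) (hDo : IsOpen D) (hDc : IsConnected D)
    (V : State n → ℝ → ℝ) (Wl Wu W : State n → ℝ) :
    -- Krasovskii regularizations
    (KrasovskiiData t₀ N₀ f ρ →
      IsCommonNonStrictLyapunov N₀ (fun σ => krasovskiiReg (f σ)) t₀ D V Wl Wu W →
      (∀ r : ℝ, 0 < r → Metric.closedBall 0 r ⊆ D →
        ∀ c : ℝ, 0 < c → (∀ y ∈ Metric.sphere (0 : State n) r, c < Wl y) →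
          SolutionsCompleteBoundedConverge (krasovskiiReg (switchedField f ρ)) t₀ W
            {x | x ∈ Metric.ball 0 r ∧ Wu x ≤ c}) ∧
      (D = univ → (∀ c : ℝ, 0 < c → IsCompact {x | Wl x ≤ c}) →
        SolutionsCompleteBoundedConverge (krasovskiiReg (switchedField f ρ)) t₀ W univ)) ∧
    -- Filippov regularizations
    (FilippovData t₀ N₀ f ρ →
      IsCommonNonStrictLyapunov N₀ (fun σ => filippovReg (f σ)) t₀ D V Wl Wu W →
      (∀ r : ℝ, 0 < r → Metric.closedBall 0 r ⊆ D →
        ∀ c : ℝ, 0 < c → (∀ y ∈ Metric.sphere (0 : State n) r, c < Wl y) →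
          SolutionsCompleteBoundedConverge (filippovReg (switchedField f ρ)) t₀ W
            {x | x ∈ Metric.ball 0 r ∧ Wu x ≤ c}) ∧
      (D = univ → (∀ c : ℝ, 0 < c → IsCompact {x | Wl x ≤ c}) →
        SolutionsCompleteBoundedConverge (filippovReg (switchedField f ρ)) t₀ W univ)) := by
  refine ⟨fun h hV => ?_, fun h hV => ?_⟩
  · simp only [krasovskiiReg_eq] at hV ⊢
    exact switched_convergence isNegligibleFamily_singleton_empty (locallyBoundedMod_krasovskii h)
      h.mode_mem hρ (hasSampling_krasovskii h) hDo hV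
  · simp only [filippovReg_eq] at hV ⊢
    exact switched_convergence isNegligibleFamily_null (locallyBoundedMod_filippov h)
      h.mode_mem hρ (hasSampling_filippov h) hDo hV
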